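/- Conventions. For an Ore domain $R$ (a two-sided Ore domain) $\operatorname{Frac} R$ denotes its skew field of fractions and $Z(R)$ its center. For a field $k$, the Weyl algebra $A_n(k)$ is generated over $k$ by $x_1,\dots,x_n,y_1,\dots,y_n$ with relations $[x_i,x_j]=[y_i,y_j]=0$, $[y_i,x_j]=\delta_{ij}$, and $\mathbb D_{n,l}(k)=\operatorname{Frac} A_n(k(t_1,\dots,t_l))$. For a $k$-algebra $A$, $\operatorname{Tdeg} A=\sup_V\inf_b \operatorname{GKdim} k[bV]$ is the Gelfand–Kirillov transcendence degree, where $V$ runs over the finite-dimensional subspaces and $b$ over the regular elements of $A$; $\operatorname{tdeg}$ is the transcendence degree of fields. A $\mathbb Z$-compatible family $\mathcal K=\{A_k\}$, $k$ ranging over all algebraically closed fields, is given by a ring $A_{\mathbb Z}$ with $A_k=A_{\mathbb Z}\otimes_{\mathbb Z}k$ such that: 1. $A_{\mathbb Z}$ and all $A_k$ are Ore domains. 2. $A_{\mathbb Z}$ has a finitely generated $\mathbb Z$-submodule $V$ (the degree-one generators; $1\in V$ is allowed but not required) such that the modules $A_i^{\mathbb Z}=(\mathbb Z+V)^i$, $i\ge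 0$, are finitely generated and free over $\mathbb Z$, $A_0^{\mathbb Z}=\mathbb Z$ and $\bigcup_i A_i^{\mathbb Z}=A_{\mathbb Z}$. For every algebraically closed $k$ the maps $A_i^{\mathbb Z}\otimes k\to A_k$ and $V\otimes k\to A_k$ are injective, so that the $A_i^k=A_i^{\mathbb Z}\otimes k$ form a finite-dimensional filtration of $A_k$. 3. If $\operatorname{char} k=0$, then $Z(\operatorname{Frac} A_k)\cong\operatorname{Frac} Z(A_k)$ as $k$-algebras. 4. For every algebraically closed $k$, $\operatorname{Tdeg}\operatorname{Frac}A_k=\dim_k (V\otimes k)$. 5. There are $z_1,\dots,z_s\in A_{\mathbb Z}$ such that, for every algebraically closed $k$ of characteristic $0$, $Z(A_k)$ is the polynomial algebra $k[z_1,\dots,z_s]$, and such that the images of $z_1,\dots,z_s$ in $A_F$ are central for every algebraically closed $F$ of prime characteristic. For $k$ algebraically closed of characteristic $0$, the Gelfand–Kirillov Conjecture holds for $A_k$ if there are $n,l\ge 0$ with $\operatorname{Frac}A_k\cong\mathbb D_{n,l}(k)$ as $k$-algebras, $\operatorname{Tdeg}\operatorname{Frac}A_k=2n+l$ and $l=\operatorname{tdeg}\operatorname{Frac}Z(A_k)$.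 For $F$ algebraically closed of prime characteristic, the modular Gelfand–Kirillov Conjecture holds for $A_F$ if $\operatorname{Frac}A_F$ is a Weyl field over a purely transcendental extension of $F$, that is, $\operatorname{Frac}A_F\cong\mathbb D_{n,l}(F)$ as $F$-algebras for some $n,l\ge 0$. **Theorem.** Let $\mathcal K=\{A_k\}$ be a $\mathbb Z$-compatible family. Suppose that the Gelfand–Kirillov Conjecture holds for $A_k$ for some algebraically closed field $k$ of characteristic $0$. Then it holds for $A_k$ for every algebraically closed field $k$ of characteristic $0$, and there is $N$, depending only on $\mathcal K$, such that for every prime $p>N$ and every algebraically closed field $F$ of characteristic $p$ the modular Gelfand–Kirillov Conjecture holds for $A_F$. -/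

import Mathlib

universe u v

open scoped TensorProduct nonZeroDivisors

noncomputable section

namespace GK

/-! ### Ore domains and their skew fields of fractions -/

/-- A (two-sided) Ore domain. -/
class IsOreDomain (R : Type*) [Ring R] : Prop where
  isDomain : IsDomain R
  left_ore : ∀ a b : R, b ≠ 0 → ∃ c d : R, d ≠ 0 ∧ d * a = c * b
  right_ore : ∀ a b : R, b ≠ 0 → ∃ c d : R, d ≠ 0 ∧ a * d = b * c

attribute [instance] IsOreDomain.isDomain

/-- The nonzero elements of an Ore domain form an Ore set. -/
instance IsOreDomain.oreSet (R : Type*) [Ring R] [IsOreDomain R] :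
    OreLocalization.OreSet R⁰ :=
  Classical.choice <| OreLocalization.nonempty_oreSet_iff_of_noZeroDivisors.mpr fun r s => by
    obtain ⟨c, d, hd, h⟩ := IsOreDomain.left_ore r (s : R) (nonZeroDivisors.coe_ne_zero s)
    exact ⟨c, ⟨d, mem_nonZeroDivisors_of_ne_zero hd⟩, h⟩

/-- The skew field of fractions `Frac R` of an Ore domain `R`. -/
abbrev SkewFrac (R : Type*) [Ring R] [IsOreDomain R] : Type _ :=
  OreLocalization R⁰ R

/-- The homomorphism `f` exhibits the skew field `D` as the skew field of fractions of `R`: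
it is injective and every element of `D` has the form `f(s)⁻¹ f(a)` with `s ≠ 0`. -/
def IsSkewFractionMap {R D : Type*} [Ring R] [DivisionRing D] (f : R →+* D) : Prop :=
  Function.Injective f ∧ ∀ q : D, ∃ a s : R, s ≠ 0 ∧ q = (f s)⁻¹ * f a

/-! ### Weyl algebras and Weyl fields -/

/-- The defining relations of the `n`-th Weyl algebra; `Sum.inl i` stands for `x_i` and
`Sum.inr i` for `y_i`. -/
inductive WeylRel (K : Type u) [CommRing K] (n : ℕ) :
    FreeAlgebra K (Fin n ⊕ Fin n) → FreeAlgebra K (Fin n ⊕ Fin n) → Prop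
  | x_comm (i j : Fin n) : WeylRel K n
      (FreeAlgebra.ι K (Sum.inl i) * FreeAlgebra.ι K (Sum.inl j))
      (FreeAlgebra.ι K (Sum.inl j) * FreeAlgebra.ι K (Sum.inl i))
  | y_comm (i j : Fin n) : WeylRel K n
      (FreeAlgebra.ι K (Sum.inr i) * FreeAlgebra.ι K (Sum.inr j))
      (FreeAlgebra.ι K (Sum.inr j) * FreeAlgebra.ι K (Sum.inr i))
  | y_x (i j : Fin n) : WeylRel K n
      (FreeAlgebra.ι K (Sum.inr i) * FreeAlgebra.ι K (Sum.inl j))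
      (FreeAlgebra.ι K (Sum.inl j) * FreeAlgebra.ι K (Sum.inr i) + if i = j then 1 else 0)

/-- The `n`-th Weyl algebra `A_n(K)`. -/
abbrev WeylAlgebra (K : Type u) [CommRing K] (n : ℕ) : Type u :=
  RingQuot (WeylRel K n)

/-- The purely transcendental extension `k(t_1, …, t_l)`. -/
abbrev RatFun (k : Type u) [Field k] (l : ℕ) : Type u :=
  FractionRing (MvPolynomial (Fin l) k)

/-- `D` is isomorphic, as a `k`-algebra, to the Weyl field `𝔻_{n,l}(k)`, the skew field of
fractions of `A_n(k(t_1, …, t_l))`. -/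
def IsWeylField (k : Type u) [Field k] (n l : ℕ) (D : Type*) [DivisionRing D] [Algebra k D] :
    Prop :=
  ∃ f : WeylAlgebra (RatFun k l) n →ₐ[k] D, IsSkewFractionMap f.toRingHom

/-! ### Gelfand–Kirillov dimension and transcendence degree -/

/-- The Gelfand–Kirillov dimension: the supremum over finite-dimensional subspaces `W` of
`limsup_n log_n dim (k + W)^n`. -/
def gkDim (k : Type*) (A : Type*) [Field k] [Ring A] [Algebra k A] : EReal :=
  ⨆ (W : Submodule k A) (_ : W.FG),
    Filter.limsup
      (fun n : ℕ =>
        ((Real.log (Module.finrank k ↥((1 ⊔ W) ^ n : Submodule k A)) / Real.log n : ℝ) : EReal))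
      Filter.atTop

/-- The Gelfand–Kirillov transcendence degree `sup_V inf_b GKdim k[bV]`, with `V` running over the
finite-dimensional subspaces and `b` over the regular elements. -/
def tdeg (k : Type*) (A : Type*) [Field k] [Ring A] [Algebra k A] : EReal :=
  ⨆ (V : Submodule k A) (_ : V.FG), ⨅ b ∈ A⁰,
    gkDim k (Algebra.adjoin k ((fun v => b * v) '' (V : Set A)))

/-! ### `ℤ`-compatible families -/

/-- A `ℤ`-compatible family `{A_k}` of algebras, `A_k = k ⊗ A_ℤ` for algebraically closed `k`.

`gen` is the degree-one part of the filtration. It may contain `1`, and then `fil i = gen ^ i` for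
`i ≥ 1`; but `1` may also be left out, as for the subspace `𝔤` of an enveloping algebra `U(𝔤)`. -/
structure ZCompatibleFamily where
  /-- the ring `A_ℤ` -/
  ring : Type v
  [instRing : Ring ring]
  [ore_int : IsOreDomain ring]
  [ore : ∀ (k : Type u) [Field k] [IsAlgClosed k], IsOreDomain (k ⊗[ℤ] ring)]
  /-- the degree-one part of `A_ℤ` -/
  gen : Submodule ℤ ring
  gen_fg : gen.FG
  /-- the filtration `A_i^ℤ` of `A_ℤ` -/
  fil : ℕ → Submodule ℤ ring
  fil_eq : ∀ i, fil i = (1 ⊔ gen) ^ i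
  /-- `A_0 = ℤ` -/
  int_injective : Function.Injective (Int.cast : ℤ → ring)
  fil_finite : ∀ i, Module.Finite ℤ (fil i)
  fil_free : ∀ i, Module.Free ℤ (fil i)
  fil_exhaustive : ⨆ i, fil i = ⊤
  /-- `k ⊗ A_i^ℤ` is a subspace of `A_k`, so that these subspaces filter `A_k` -/
  fil_baseChange : ∀ (k : Type u) [Field k] [IsAlgClosed k] (i : ℕ),
    Function.Injective ((fil i).subtype.baseChange k)
  gen_baseChange : ∀ (k : Type u) [Field k] [IsAlgClosed k],
    Function.Injective (gen.subtype.baseChange k)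
  center_frac : ∀ (k : Type u) [Field k] [IsAlgClosed k] [CharZero k],
    Nonempty (Subalgebra.center k (SkewFrac (k ⊗[ℤ] ring)) ≃ₐ[k]
      FractionRing (Subalgebra.center k (k ⊗[ℤ] ring)))
  tdeg_frac : ∀ (k : Type u) [Field k] [IsAlgClosed k],
    tdeg k (SkewFrac (k ⊗[ℤ] ring)) = (Module.finrank k (gen.baseChange k) : EReal)
  /-- the number of generators of the center in characteristic `0` -/
  numCentral : ℕ
  /-- the generators of the center in characteristic `0` -/
  central : Fin numCentral → ring
  center_polynomial : ∀ (k : Type u) [Field k] [IsAlgClosed k] [CharZero k],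
    ∃ e : MvPolynomial (Fin numCentral) k ≃ₐ[k] Subalgebra.center k (k ⊗[ℤ] ring),
      ∀ i, (e (MvPolynomial.X i) : k ⊗[ℤ] ring) = 1 ⊗ₜ central i
  central_mem : ∀ (F : Type u) [Field F] [IsAlgClosed F] (p : ℕ) [Fact p.Prime] [CharP F p],
    ∀ i, (1 ⊗ₜ central i : F ⊗[ℤ] ring) ∈ Subalgebra.center F (F ⊗[ℤ] ring)

namespace ZCompatibleFamily

attribute [instance] instRing ore_int ore

/-- The member `A_k` of the family. -/
abbrev alg (K : ZCompatibleFamily.{u, v}) (k : Type u) [Field k] : Type (max u v) :=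
  k ⊗[ℤ] K.ring

/-- The Gelfand–Kirillov conjecture holds for `A_k` (`k` of characteristic `0`):
`Frac A_k ≅ 𝔻_{n,l}(k)`, where `Tdeg Frac A_k = 2n + l` and `l = tdeg Frac Z(A_k)`. -/
def GelfandKirillov (K : ZCompatibleFamily.{u, v}) (k : Type u) [Field k] [IsAlgClosed k] : Prop :=
  ∃ n l : ℕ, IsWeylField k n l (SkewFrac (K.alg k)) ∧
    tdeg k (SkewFrac (K.alg k)) = ((2 * n + l : ℕ) : EReal) ∧
    Algebra.trdeg k (FractionRing (Subalgebra.center k (K.alg k))) = l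

/-- The modular Gelfand–Kirillov conjecture holds for `A_F` (`F` of prime characteristic):
`Frac A_F` is a Weyl field over a purely transcendental extension of `F`. -/
def ModularGelfandKirillov (K : ZCompatibleFamily.{u, v}) (F : Type u) [Field F] [IsAlgClosed F] :
    Prop :=
  ∃ n l : ℕ, IsWeylField F n l (SkewFrac (K.alg F))

end ZCompatibleFamily

end GK

end

noncomputable section

namespace GK

/-! ### Extension of places -/

/-! An isomorphism of `Frac A_k` with a Weyl field is described by finitely many fractions, so it
involves a finite set of scalars of `k`. By Zariski's lemma and Chevalley's extension of places,
these scalars lie in a valuation subring `O` of `k` with a homomorphism `φ : O → F`, for every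
algebraically closed `F` in which a certain nonzero integer `m` is nonzero
(`exists_valuationSubring_hom_of_finset`). Fields `F` of characteristic zero are included, so one
argument serves both halves of the theorem.

Fractions over `O ⊗ A_ℤ` whose denominator survives in `A_F` specialize to `Frac A_F`. They form a
ring because `O` is a valuation ring: solutions of an Ore equation can be rescaled so as not to
vanish under `φ` (`ore_condition_specialization`). The Weyl generators thus specialize to a Weyl
system `w` in `Frac A_F`. The equations expressing generators of `A_ℤ` as fractions in the old Weyl
generators specialize too, so `Frac A_F` consists of fractions of the algebra generated by `w`
(`exists_weylSystem_of_spec`).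

It remains to exclude further relations. Simplicity of the Weyl algebra fails in characteristic `p`,
so dimension is used: a linear relation among the monomials in `w` would lower the growth exponent
below `2n + l`, whereas `Tdeg Frac A_F = dim V = 2n + l` over every field
(`linearIndependent_mon_of_tdeg`, `IsWeylSystem.isWeylField`). -/

open IsLocalRing in
theorem exists_hom_extending_of_finiteType_field {R L F : Type*} [CommRing R] [IsLocalRing R]
    [Field L] [Field F] [IsAlgClosed F] [Algebra R L] [Algebra.FiniteType R L]
    (hL : IsLocalHom (algebraMap R L)) (b : R →+* F) (hb : IsLocalHom b) :
    ∃ g : L →+* F, g.comp (algebraMap R L) = b := by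
  let : Algebra (ResidueField R) L := (ResidueField.lift (algebraMap R L)).toAlgebra
  let : Algebra (ResidueField R) F := (ResidueField.lift b).toAlgebra
  have : IsScalarTower R (ResidueField R) L := IsScalarTower.of_algebraMap_eq fun _ => rfl
  have : Algebra.FiniteType (ResidueField R) L :=
    Algebra.FiniteType.of_restrictScalars_finiteType R _ _
  -- Zariski's lemma: `L` is finite over the residue field, hence embeds over it into the
  -- algebraically closed `F`.
  have := finite_of_finite_type_of_isJacobsonRing (ResidueField R) L
  let g : L →ₐ[ResidueField R] F := IsAlgClosed.lift
  refine ⟨g, ?_⟩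
  ext y
  exact g.commutes (residue R y)

open IsLocalRing in
theorem exists_hom_extending_of_map_maximalIdeal_ne_top {R S F : Type*} [CommRing R]
    [IsLocalRing R] [CommRing S] [Field F] [IsAlgClosed F] [Algebra R S] [Algebra.FiniteType R S]
    (b : R →+* F) (hb : IsLocalHom b) (hS : (maximalIdeal R).map (algebraMap R S) ≠ ⊤) :
    ∃ g : S →+* F, g.comp (algebraMap R S) = b := by
  obtain ⟨M, hM, hle⟩ := Ideal.exists_le_maximal _ hS
  let : Field (S ⧸ M) := Ideal.Quotient.field M
  have : Algebra.FiniteType R (S ⧸ M) :=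
    Algebra.FiniteType.of_surjective (Ideal.Quotient.mkₐ R M) Ideal.Quotient.mk_surjective
  have hL : IsLocalHom (algebraMap R (S ⧸ M)) := by
    refine ⟨fun g hg => ?_⟩
    by_contra hgu
    exact hg.ne_zero (Ideal.Quotient.eq_zero_iff_mem.2 (hle (Ideal.mem_map_of_mem _ hgu)))
  obtain ⟨g, hg⟩ := exists_hom_extending_of_finiteType_field hL b hb
  exact ⟨g.comp (Ideal.Quotient.mk M), hg⟩

-- If the maximal ideal generates the unit ideal of `R[x]`, then `x⁻¹` is a root of a polynomial
-- whose leading coefficient is `1` modulo that ideal, hence a unit. So `x⁻¹` is integral over `R`,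
-- and lying over gives a maximal ideal of `R[x⁻¹]` above that of `R`.
open IsLocalRing in
theorem map_maximalIdeal_adjoin_inv_ne_top {R k : Type*} [CommRing R] [IsDomain R] [IsLocalRing R]
    [Field k] [Algebra R k] [FaithfulSMul R k] {x : k} (hx0 : x ≠ 0)
    (htop : (maximalIdeal R).map (algebraMap R (Algebra.adjoin R {x})) = ⊤) :
    (maximalIdeal R).map (algebraMap R (Algebra.adjoin R {x⁻¹})) ≠ ⊤ := by
  let := invertibleOfNonzero hx0
  obtain ⟨p, hp, hpx⟩ := Algebra.exists_aeval_invOf_eq_zero_of_idealMap_adjoin_sup_span_eq_top x _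
    (maximalIdeal.isMaximal R).ne_top (top_unique <| htop.ge.trans le_self_add)
  have H : IsUnit p.leadingCoeff := of_not_not fun h ↦ by simpa using sub_mem h hp
  have hxint : IsIntegral R x⁻¹ :=
    ⟨.C H.unit⁻¹.1 * p, by simp [Polynomial.Monic], by
      rw [← invOf_eq_inv]; simpa using .inr hpx⟩
  intro htop'
  have : Algebra.IsIntegral R (Algebra.adjoin R {x⁻¹}) :=
    Algebra.IsIntegral.adjoin (by simpa using hxint)
  obtain ⟨Q, hQ, hQe⟩ := Ideal.exists_ideal_over_maximal_of_isIntegral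
    (S := Algebra.adjoin R {x⁻¹}) (maximalIdeal R) (le_maximalIdeal (by simp))
  refine hQ.ne_top (top_unique (htop'.ge.trans ?_))
  rw [Ideal.map_le_iff_le_comap]
  exact hQe.ge

section Place

variable {k F : Type*} [Field k] [Field F]

/-- The graph of a partially defined ring homomorphism from `k` to `F`. -/
def IsPartialHom (Γ : Subring (k × F)) : Prop :=
  ∀ y : F, ((0 : k), y) ∈ Γ → y = 0

theorem exists_maximal_isPartialHom {Γ₀ : Subring (k × F)} (h₀ : IsPartialHom Γ₀) :
    ∃ Γ, Γ₀ ≤ Γ ∧ Maximal IsPartialHom Γ := by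
  refine zorn_le_nonempty₀ {Γ | IsPartialHom Γ} ?_ Γ₀ h₀
  intro c hc hchain Γ₁ hΓ₁
  refine ⟨sSup c, ?_, fun Γ hΓ => le_sSup hΓ⟩
  intro y hy
  rw [Subring.mem_sSup_of_directedOn ⟨Γ₁, hΓ₁⟩ hchain.directedOn] at hy
  obtain ⟨Γ, hΓ, hy⟩ := hy
  exact hc hΓ y hy

variable {Γ : Subring (k × F)}

/-- The domain inclusion of a partial homomorphism. -/
def domHom (Γ : Subring (k × F)) : Γ →+* k := (RingHom.fst k F).comp Γ.subtype

/-- The value of a partial homomorphism. -/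
def valHom (Γ : Subring (k × F)) : Γ →+* F := (RingHom.snd k F).comp Γ.subtype

theorem IsPartialHom.domHom_injective (h : IsPartialHom Γ) : Function.Injective (domHom Γ) := by
  rw [injective_iff_map_eq_zero]
  rintro ⟨⟨a, b⟩, hab⟩ (h0 : a = 0)
  subst h0
  obtain rfl := h b hab
  rfl

/-- A maximal partial homomorphism does not extend to a larger domain. -/
theorem range_le_of_maximal (hΓ : Maximal IsPartialHom Γ) {S : Type*} [CommRing S]
    (i : Γ →+* S) (a : S →+* k) (b : S →+* F) (ha : Function.Injective a)
    (hia : a.comp i = domHom Γ) (hib : b.comp i = valHom Γ) : a.range ≤ (domHom Γ).range := by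
  have hle : Γ ≤ (a.prod b).range := by
    rintro x hx
    refine ⟨i ⟨x, hx⟩, Prod.ext ?_ ?_⟩
    · exact congrArg (fun f : Γ →+* k => f ⟨x, hx⟩) hia
    · exact congrArg (fun f : Γ →+* F => f ⟨x, hx⟩) hib
  have hP : IsPartialHom (a.prod b).range := by
    rintro y ⟨s, hs⟩
    have h1 : a s = 0 := congrArg Prod.fst hs
    have h2 : b s = y := congrArg Prod.snd hs
    rw [(injective_iff_map_eq_zero a).1 ha s h1, map_zero] at h2
    exact h2.symm
  rintro x ⟨s, rfl⟩
  exact ⟨⟨(a s, b s), hΓ.2 hP hle ⟨s, rfl⟩⟩, rfl⟩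

/-- The partial homomorphism extends to the localization at the elements of nonzero value; by
maximality nothing new is obtained, so these elements are already invertible. -/
theorem isUnit_of_valHom_ne_zero (hΓ : Maximal IsPartialHom Γ) {g : Γ} (hg : valHom Γ g ≠ 0) :
    IsUnit g := by
  have hinj := IsPartialHom.domHom_injective hΓ.1
  let M : Submonoid Γ := (nonZeroDivisors F).comap (valHom Γ)
  have hMF : ∀ y : M, IsUnit (valHom Γ y) := fun y =>
    IsUnit.mk0 _ (nonZeroDivisors.ne_zero y.2)
  have hMk : ∀ y : M, IsUnit (domHom Γ y) := by
    intro y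
    refine IsUnit.mk0 _ fun h0 => ?_
    have := (injective_iff_map_eq_zero _).1 hinj _ h0
    exact (hMF y).ne_zero (by rw [this, map_zero])
  have ha : Function.Injective (IsLocalization.lift (S := Localization M) hMk) := by
    rw [injective_iff_map_eq_zero]
    intro z hz
    obtain ⟨r, s, rfl⟩ := IsLocalization.exists_mk'_eq M z
    rw [IsLocalization.lift_mk', Units.mul_left_eq_zero] at hz
    rw [(injective_iff_map_eq_zero _).1 hinj _ hz, IsLocalization.mk'_zero]
  have key := range_le_of_maximal hΓ (algebraMap Γ (Localization M)) _
    (IsLocalization.lift hMF) ha (IsLocalization.lift_comp _) (IsLocalization.lift_comp _)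
  have hgM : g ∈ M := mem_nonZeroDivisors_of_ne_zero hg
  obtain ⟨g', hg'⟩ := key ⟨IsLocalization.mk' _ 1 ⟨g, hgM⟩, rfl⟩
  rw [IsLocalization.lift_mk'] at hg'
  refine isUnit_iff_exists_inv.2 ⟨g', hinj ?_⟩
  rw [map_mul, hg', map_one, one_mul]
  exact IsUnit.mul_liftRight_inv ((domHom Γ : Γ →* k).domRestrict M) hMk ⟨g, hgM⟩

theorem isLocalHom_valHom (hΓ : Maximal IsPartialHom Γ) : IsLocalHom (valHom Γ) :=
  ⟨fun _ hg => isUnit_of_valHom_ne_zero hΓ hg.ne_zero⟩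

open IsLocalRing in
theorem mem_range_of_map_maximalIdeal_ne_top [IsAlgClosed F] (hΓ : Maximal IsPartialHom Γ)
    [IsLocalRing Γ] [Algebra Γ k] (halg : algebraMap Γ k = domHom Γ) (x : k)
    (hx : (maximalIdeal Γ).map (algebraMap Γ (Algebra.adjoin Γ {x})) ≠ ⊤) :
    x ∈ (domHom Γ).range := by
  have : Algebra.FiniteType Γ (Algebra.adjoin Γ {x}) :=
    (Subalgebra.fg_iff_finiteType _).1 ⟨{x}, by simp⟩
  obtain ⟨g, hg⟩ := exists_hom_extending_of_map_maximalIdeal_ne_top (valHom Γ)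
    (isLocalHom_valHom hΓ) hx
  refine range_le_of_maximal hΓ (algebraMap Γ _) ((Algebra.adjoin Γ {x}).val : _ →+* k) g
    Subtype.val_injective ?_ hg ⟨⟨x, Algebra.self_mem_adjoin_singleton _ _⟩, rfl⟩
  rw [← halg]; rfl

open IsLocalRing in
/-- A ring homomorphism from a subring of a field `k` to an algebraically closed field
extends to a valuation subring of `k`. -/
theorem exists_valuationSubring_hom [IsAlgClosed F] (R : Subring k) (φ : R →+* F) :
    ∃ (O : ValuationSubring k) (ψ : O →+* F), R ≤ O.toSubring ∧ IsLocalHom ψ := by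
  have h₀ : IsPartialHom (R.subtype.prod φ).range := by
    rintro y ⟨s, hs⟩
    have h1 : (s : k) = 0 := congrArg Prod.fst hs
    have h2 : φ s = y := congrArg Prod.snd hs
    rw [← h2, show s = 0 from Subtype.ext h1, map_zero]
  obtain ⟨Γ, hle, hΓ⟩ := exists_maximal_isPartialHom h₀
  have hinj := IsPartialHom.domHom_injective hΓ.1
  have hloc : IsLocalRing Γ := by
    refine IsLocalRing.of_nonunits_add fun a b ha hb hab => ?_
    have := fun (g : Γ) (hg : g ∈ nonunits Γ) =>
      not_not.1 (mt (isUnit_of_valHom_ne_zero hΓ) hg)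
    exact (hab.map (valHom Γ)).ne_zero (by rw [map_add, this a ha, this b hb, add_zero])
  let : Algebra Γ k := (domHom Γ).toAlgebra
  have : FaithfulSMul Γ k := (faithfulSMul_iff_algebraMap_injective Γ k).2 hinj
  have : IsDomain Γ := hinj.isDomain (domHom Γ)
  -- By maximality, an element outside the domain makes the maximal ideal generate the unit ideal
  -- after its adjunction; this cannot happen for both `x` and `x⁻¹`.
  have hval : ∀ x : k, x ∈ (domHom Γ).range ∨ x⁻¹ ∈ (domHom Γ).range := by
    intro x
    by_contra! h
    have hx0 : x ≠ 0 := by rintro rfl; exact h.1 (zero_mem _)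
    have htop (y : k) (hy : y ∉ (domHom Γ).range) :
        (maximalIdeal Γ).map (algebraMap Γ (Algebra.adjoin Γ {y})) = ⊤ := by
      by_contra h
      exact hy (mem_range_of_map_maximalIdeal_ne_top hΓ rfl y h)
    exact map_maximalIdeal_adjoin_inv_ne_top hx0 (htop x h.1) (htop _ h.2)
  let e := RingEquiv.ofBijective (domHom Γ).rangeRestrict
    ⟨fun a b h => hinj (congrArg Subtype.val h), (domHom Γ).rangeRestrict_surjective⟩
  refine ⟨⟨(domHom Γ).range, hval⟩, (valHom Γ).comp (e.symm : (domHom Γ).range →+* Γ), ?_, ?_⟩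
  · intro x hx
    exact ⟨⟨(x, φ ⟨x, hx⟩), hle ⟨⟨x, hx⟩, rfl⟩⟩, rfl⟩
  · refine ⟨fun y hy => ?_⟩
    have : IsUnit (e.symm y) := isUnit_of_valHom_ne_zero hΓ hy.ne_zero
    simpa using this.map e

/-- Take for `m` a common denominator, so that `m y` is integral over `ℤ` for `y ∈ t`. The map `ℤ →
F` extends to a local homomorphism on a valuation subring; there `m` is a unit, and integral
closedness puts `m y`, hence `y`, in it. -/
theorem exists_subring_hom_of_finiteDimensional {L : Type*} [Field L] [Algebra ℚ L]
    [FiniteDimensional ℚ L] (t : Finset L) :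
    ∃ m : ℤ, m ≠ 0 ∧ ∀ (F : Type*) [Field F] [IsAlgClosed F], (m : F) ≠ 0 →
      ∃ R : Subring L, (t : Set L) ⊆ R ∧ Nonempty (R →+* F) := by
  have : CharZero L := algebraRat.charZero L
  obtain ⟨m, hm0, hm⟩ := exists_integral_multiples ℤ ℚ t
  refine ⟨m, hm0, fun F _ _ hmF => ?_⟩
  let c : ℤ →+* L := Int.castRingHom _
  have hc : Function.Injective c := Int.cast_injective
  let e := RingEquiv.ofBijective c.rangeRestrict
    ⟨fun a b h => hc (congrArg Subtype.val h), c.rangeRestrict_surjective⟩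
  obtain ⟨O, ψ, -, hψ⟩ := exists_valuationSubring_hom c.range
    ((Int.castRingHom F).comp (e.symm : c.range →+* ℤ))
  refine ⟨O.toSubring, fun y hy => ?_, ⟨ψ⟩⟩
  have hmu : IsUnit (m : O) := by
    refine hψ.map_nonunit _ ?_
    rw [map_intCast]
    exact IsUnit.mk0 _ hmF
  obtain ⟨z, hz⟩ := IsIntegrallyClosed.isIntegral_iff.1 ((hm y hy).tower_top (A := O))
  obtain ⟨m', hm'⟩ := isUnit_iff_exists_inv'.1 hmu
  have hm'' : (m' : L) * (m : L) = 1 := by simpa using congrArg (Subtype.val) hm'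
  have hz' : (z : L) = m * y := by rw [← zsmul_eq_mul]; exact hz
  have : y = m' * z := by rw [hz', ← mul_assoc, hm'', one_mul]
  rw [this]
  exact mul_mem m'.2 z.2

theorem exists_maximal_finite_quotient (A : Type*) [CommRing A] [Nontrivial A] [Algebra ℚ A]
    [Algebra.FiniteType ℚ A] : ∃ M : Ideal A, M.IsMaximal ∧ Module.Finite ℚ (A ⧸ M) := by
  obtain ⟨M, hM⟩ := Ideal.exists_maximal A
  let := Ideal.Quotient.field M
  have : Algebra.FiniteType ℚ (A ⧸ M) :=
    Algebra.FiniteType.of_surjective (Ideal.Quotient.mkₐ ℚ M) Ideal.Quotient.mk_surjective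
  have := finite_of_finite_type_of_isJacobsonRing ℚ (A ⧸ M)
  exact ⟨M, hM, this⟩

/-- For every finite subset `s` of a field `k` of characteristic zero, all algebraically closed
fields `F` outside finitely many prime characteristics receive a homomorphism from a valuation
subring of `k` containing `s`. -/
theorem exists_valuationSubring_hom_of_finset [CharZero k] (s : Finset k) :
    ∃ m : ℤ, m ≠ 0 ∧ ∀ (F : Type*) [Field F] [IsAlgClosed F], (m : F) ≠ 0 →
      ∃ O : ValuationSubring k, (s : Set k) ⊆ O ∧ Nonempty (O →+* F) := by
  classical
  let A := Algebra.adjoin ℚ (s : Set k)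
  have : Algebra.FiniteType ℚ A := (Subalgebra.fg_iff_finiteType _).1 ⟨s, rfl⟩
  -- A closed point of `Spec ℚ[s]` has a number field as residue field, which reduces the claim to
  -- the previous case.
  obtain ⟨M, hM, halg⟩ := exists_maximal_finite_quotient A
  let := Ideal.Quotient.field M
  obtain ⟨m, hm0, hm⟩ := exists_subring_hom_of_finiteDimensional
    (s.attach.image fun x : {x // x ∈ s} => Ideal.Quotient.mk M ⟨x.1, Algebra.subset_adjoin x.2⟩)
  refine ⟨m, hm0, fun F _ _ hmF => ?_⟩
  obtain ⟨R, hR, ⟨ψ⟩⟩ := hm F hmF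
  -- The preimage of `R` in `ℚ[s]` contains `s` and maps to `F`; this map is then extended to a
  -- valuation subring of `k`.
  let R' : Subring A := R.comap (Ideal.Quotient.mk M)
  let e := R'.equivMapOfInjective (A.val : A →+* k) Subtype.val_injective
  let f : R' →+* R := (Ideal.Quotient.mk M).restrict R' R fun x hx => hx
  obtain ⟨O, χ, hO, -⟩ := exists_valuationSubring_hom (R'.map (A.val : A →+* k))
    ((ψ.comp f).comp (e.symm : _ →+* R'))
  refine ⟨O, fun x hx => hO ⟨⟨x, Algebra.subset_adjoin hx⟩, hR ?_, rfl⟩, ⟨χ⟩⟩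
  exact Finset.mem_image.2 ⟨⟨x, hx⟩, Finset.mem_attach _ _, rfl⟩

end Place

/-! ### Specialization of skew fields of fractions -/

theorem ne_zero_of_injective {R D : Type*} [Ring R] [DivisionRing D] {f : R →+* D}
    (hf : Function.Injective f) {x : R} (hx : x ≠ 0) : f x ≠ 0 :=
  (map_ne_zero_iff f hf).2 hx

section SpecGraph

variable {P D E : Type*} [Ring P] [DivisionRing D] [DivisionRing E]

/-- The pairs `(i(s)⁻¹ i(a), j(s)⁻¹ j(a))` with `j(s) ≠ 0`: the graph of the specialization
from (a subring of) `D` to `E` induced by the homomorphisms `i` and `j`. -/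
def specGraph (i : P →+* D) (j : P →+* E)
    (hore : ∀ a b : P, j b ≠ 0 → ∃ c d : P, j d ≠ 0 ∧ d * a = c * b) : Subring (D × E) where
  carrier := {q | ∃ s a : P, j s ≠ 0 ∧ i s * q.1 = i a ∧ j s * q.2 = j a}
  zero_mem' := ⟨1, 0, by simp⟩
  one_mem' := ⟨1, 1, by simp⟩
  neg_mem' := by
    rintro ⟨x, y⟩ ⟨s, a, hs, hx, hy⟩
    exact ⟨s, -a, hs, by simpa using hx, by simpa using hy⟩
  add_mem' := by
    rintro ⟨x, y⟩ ⟨x', y'⟩ ⟨s, a, hs, hx, hy⟩ ⟨s', a', hs', hx', hy'⟩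
    obtain ⟨c, d, hd, hcd⟩ := hore s s' hs'
    have hi := congrArg i hcd
    have hj := congrArg j hcd
    simp only [map_mul] at hi hj
    dsimp only at hx hy hx' hy'
    refine ⟨d * s, d * a + c * a', by rw [map_mul]; exact mul_ne_zero hd hs, ?_, ?_⟩
    · simp only [Prod.fst_add, map_mul, map_add, mul_add, ← hx, ← hx', ← mul_assoc, hi]
    · simp only [Prod.snd_add, map_mul, map_add, mul_add, ← hy, ← hy', ← mul_assoc, hj]
  mul_mem' := by
    rintro ⟨x, y⟩ ⟨x', y'⟩ ⟨s, a, hs, hx, hy⟩ ⟨s', a', hs', hx', hy'⟩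
    obtain ⟨c, d, hd, hcd⟩ := hore a s' hs'
    have hi := congrArg i hcd
    have hj := congrArg j hcd
    simp only [map_mul] at hi hj
    dsimp only at hx hy hx' hy'
    refine ⟨d * s, c * a', by rw [map_mul]; exact mul_ne_zero hd hs, ?_, ?_⟩
    · rw [map_mul, map_mul, Prod.fst_mul, ← hx', ← mul_assoc (i c), ← hi, ← hx]
      simp only [mul_assoc]
    · rw [map_mul, map_mul, Prod.snd_mul, ← hy', ← mul_assoc (j c), ← hj, ← hy]
      simp only [mul_assoc]

variable {i : P →+* D} {j : P →+* E}
  {hore : ∀ a b : P, j b ≠ 0 → ∃ c d : P, j d ≠ 0 ∧ d * a = c * b}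

theorem mk_mem_specGraph (a : P) : (i a, j a) ∈ specGraph i j hore :=
  ⟨1, a, by simp⟩

/-- A fraction that is zero in `D` has numerator zero in `P`, hence also in `E`. This makes
specialization single-valued. -/
theorem eq_zero_of_mem_specGraph (hi : Function.Injective i) {y : E}
    (h : ((0 : D), y) ∈ specGraph i j hore) : y = 0 := by
  obtain ⟨s, a, hs, hx, hy⟩ := h
  have : a = 0 := (injective_iff_map_eq_zero i).1 hi a (by simpa using hx.symm)
  simpa [this, hs] using hy

theorem eq_of_mem_specGraph (hi : Function.Injective i) {x : D} {y y' : E}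
    (h : (x, y) ∈ specGraph i j hore) (h' : (x, y') ∈ specGraph i j hore) : y = y' := by
  rw [← sub_eq_zero]
  refine eq_zero_of_mem_specGraph (hore := hore) hi ?_
  simpa using sub_mem h h'

end SpecGraph

/-! ### Coordinates along the filtration and change of scalars -/

namespace ZCompatibleFamily

variable (K : ZCompatibleFamily.{u, v})

theorem fil_mono : Monotone K.fil := by
  intro i j hij
  rw [K.fil_eq, K.fil_eq]
  exact pow_le_pow_right₀ (le_sup_left (b := K.gen)) hij

instance (i : ℕ) : Module.Free ℤ (K.fil i) := K.fil_free i
instance (i : ℕ) : Module.Finite ℤ (K.fil i) := K.fil_finite i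

/-- The index type of a basis of the `i`-th step of the filtration. -/
def FilIndex (i : ℕ) : Type v := Module.Free.ChooseBasisIndex ℤ (K.fil i)

instance (i : ℕ) : Fintype (K.FilIndex i) :=
  inferInstanceAs (Fintype (Module.Free.ChooseBasisIndex ℤ (K.fil i)))

/-- A basis of the `i`-th step of the filtration. -/
def filBasis (i : ℕ) : Module.Basis (K.FilIndex i) ℤ (K.fil i) :=
  Module.Free.chooseBasis ℤ (K.fil i)

/-- The element of `R ⊗ A_ℤ` with the given coordinates. -/
def ofCoords {R : Type*} [CommRing R] {i : ℕ} (c : K.FilIndex i → R) : R ⊗[ℤ] K.ring :=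
  ∑ j, c j ⊗ₜ[ℤ] (K.filBasis i j : K.ring)

/-- The homomorphism `R ⊗ A_ℤ → S ⊗ A_ℤ` induced by `R → S`. -/
def mapScalars {R S : Type*} [CommRing R] [CommRing S] (f : R →+* S) :
    R ⊗[ℤ] K.ring →+* S ⊗[ℤ] K.ring :=
  (Algebra.TensorProduct.map f.toIntAlgHom (AlgHom.id ℤ K.ring)).toRingHom

@[simp]
theorem mapScalars_tmul {R S : Type*} [CommRing R] [CommRing S] (f : R →+* S) (r : R)
    (a : K.ring) : K.mapScalars f (r ⊗ₜ a) = f r ⊗ₜ a := rfl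

theorem mapScalars_ofCoords {R S : Type*} [CommRing R] [CommRing S] (f : R →+* S) {i : ℕ}
    (c : K.FilIndex i → R) : K.mapScalars f (K.ofCoords c) = K.ofCoords (f ∘ c) := by
  simp [ofCoords]

theorem charZero_ring : CharZero K.ring :=
  ⟨fun a b h => by exact_mod_cast @K.int_injective a b (by simpa using h)⟩

/-- `A_ℤ` is a domain of characteristic zero, so it is torsion-free and hence flat over `ℤ`. -/
theorem mapScalars_injective {R S : Type*} [CommRing R] [CommRing S] {f : R →+* S}
    (hf : Function.Injective f) : Function.Injective (K.mapScalars f) := by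
  have := K.charZero_ring
  exact Module.Flat.rTensor_preserves_injective_linearMap
    (M := K.ring) f.toIntAlgHom.toLinearMap hf

/-- A `ℤ`-basis of a filtration step stays linearly independent in `A_F` because that step embeds
after base change. Non-vanishing under specialization can therefore be tested on coordinates. -/
theorem ofCoords_ne_zero {F : Type u} [Field F] [IsAlgClosed F] {i : ℕ} {c : K.FilIndex i → F}
    (hc : c ≠ 0) : K.ofCoords c ≠ 0 := by
  intro h0
  let b := (K.filBasis i).baseChange F
  have : (K.fil i).subtype.baseChange F (∑ j, c j • b j) = 0 := by
    rw [← h0, map_sum, ofCoords]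
    refine Finset.sum_congr rfl fun j _ => ?_
    simp [b, Module.Basis.baseChange_apply, TensorProduct.smul_tmul']
  have h1 := (injective_iff_map_eq_zero _).1 (K.fil_baseChange F i) _ this
  exact hc (funext (Fintype.linearIndependent_iff.1 b.linearIndependent c h1))

/-- Allowing every sufficiently large `i` lets several elements be written in one filtration step.
-/
theorem exists_ofCoords {k : Type u} [Field k] (x : K.alg k) :
    ∃ i₀, ∀ i, i₀ ≤ i → ∃ c : K.FilIndex i → k, x = K.ofCoords c := by
  induction x using TensorProduct.induction_on with
  | zero => exact ⟨0, fun i _ => ⟨0, by simp [ofCoords]⟩⟩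
  | add x y hx hy =>
    obtain ⟨i₁, h₁⟩ := hx
    obtain ⟨i₂, h₂⟩ := hy
    refine ⟨max i₁ i₂, fun i hi => ?_⟩
    obtain ⟨c, rfl⟩ := h₁ i ((le_max_left _ _).trans hi)
    obtain ⟨d, rfl⟩ := h₂ i ((le_max_right _ _).trans hi)
    exact ⟨c + d, by simp [ofCoords, TensorProduct.add_tmul, Finset.sum_add_distrib]⟩
  | tmul r a =>
    have ha : a ∈ ⨆ i, K.fil i := K.fil_exhaustive ▸ Submodule.mem_top
    rw [Submodule.mem_iSup_of_directed _ K.fil_mono.directed_le] at ha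
    obtain ⟨i₀, hi₀⟩ := ha
    refine ⟨i₀, fun i hi => ?_⟩
    have hai : a ∈ K.fil i := K.fil_mono hi hi₀
    refine ⟨fun j => r * ((K.filBasis i).repr ⟨a, hai⟩ j : ℤ), ?_⟩
    have h1 := congrArg (K.fil i).subtype ((K.filBasis i).sum_repr ⟨a, hai⟩)
    rw [map_sum] at h1
    change _ = a at h1
    conv_lhs => rw [← h1, TensorProduct.tmul_sum]
    refine Finset.sum_congr rfl fun j _ => ?_
    rw [map_zsmul, ← TensorProduct.smul_tmul, zsmul_eq_mul, mul_comm]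
    rfl

end ZCompatibleFamily

/-- Divide by a coordinate of maximal valuation. -/
theorem exists_scaling {k : Type*} [Field k] (O : ValuationSubring k) {J : Type*} [Finite J]
    {x : J → k} (hx : x ≠ 0) : ∃ r : k, r ≠ 0 ∧ (∀ j, r * x j ∈ O) ∧ ∃ j, r * x j = 1 := by
  obtain ⟨j₁, hj₁⟩ := Function.ne_iff.1 hx
  have : Nonempty J := ⟨j₁⟩
  obtain ⟨j₀, hj₀⟩ := Finite.exists_max fun j => O.valuation (x j)
  have h0 : x j₀ ≠ 0 := by
    intro h
    have := hj₀ j₁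
    rw [h, map_zero, le_zero_iff, map_eq_zero] at this
    exact hj₁ this
  refine ⟨(x j₀)⁻¹, inv_ne_zero h0, fun j => ?_, j₀, inv_mul_cancel₀ h0⟩
  rw [← O.valuation_le_one_iff, map_mul, map_inv₀]
  exact inv_mul_le_one_of_le₀ (hj₀ j) zero_le

namespace ZCompatibleFamily

theorem exists_lift_of_ne_zero (K : ZCompatibleFamily.{u, v}) {k : Type u} [Field k]
    {x : K.alg k} (hx : x ≠ 0) :
    ∃ s : Finset k, ∀ (F : Type u) [Field F] [IsAlgClosed F] (O : ValuationSubring k)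
      (φ : O →+* F), (s : Set k) ⊆ O →
      ∃ x' : O ⊗[ℤ] K.ring, K.mapScalars O.subtype x' = x ∧ K.mapScalars φ x' ≠ 0 := by
  classical
  obtain ⟨i, hi⟩ := K.exists_ofCoords x
  obtain ⟨c, rfl⟩ := hi i le_rfl
  have hc : c ≠ 0 := by
    rintro rfl
    exact hx (by simp [ofCoords])
  obtain ⟨j, hj⟩ := Function.ne_iff.1 hc
  -- Requiring the inverse of one nonzero coordinate makes that coordinate a unit of `O`, so `φ`
  -- cannot kill it.
  refine ⟨insert (c j)⁻¹ (Finset.univ.image c), fun F _ _ O φ hs => ?_⟩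
  have hcO : ∀ j, c j ∈ O := fun j => hs (by simp)
  have hinv : (c j)⁻¹ ∈ O := hs (by simp)
  refine ⟨K.ofCoords fun j => ⟨c j, hcO j⟩, ?_, ?_⟩
  · rw [mapScalars_ofCoords]; rfl
  · rw [mapScalars_ofCoords]
    refine K.ofCoords_ne_zero fun h0 => ?_
    have h1 : φ ⟨c j, hcO j⟩ * φ ⟨(c j)⁻¹, hinv⟩ = 1 := by
      rw [← map_mul, ← map_one φ]
      exact congrArg φ (Subtype.ext (mul_inv_cancel₀ hj))
    rw [show φ ⟨c j, hcO j⟩ = 0 from congrFun h0 j, zero_mul] at h1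
    exact zero_ne_one h1

variable (K : ZCompatibleFamily.{u, v}) {k F : Type u} [Field k] [IsAlgClosed k] [Field F]
  [IsAlgClosed F]

/-- Solve `d a = c b` in `A_k` and rescale so that all coordinates of `c` and `d` lie in `O` and one
of them is `1`. If `d` died in `A_F`, then so would `c b`, and hence `c`, since `b` survives and
`A_F` is a domain; but the coordinate `1` survives. -/
theorem ore_condition_specialization (O : ValuationSubring k) (φ : O →+* F)
    (a b : O ⊗[ℤ] K.ring) (hb : K.mapScalars φ b ≠ 0) :
    ∃ c d : O ⊗[ℤ] K.ring, K.mapScalars φ d ≠ 0 ∧ d * a = c * b := by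
  have hinj : Function.Injective (K.mapScalars O.subtype) :=
    K.mapScalars_injective Subtype.val_injective
  have hb' : K.mapScalars O.subtype b ≠ 0 := by
    intro h
    rw [(injective_iff_map_eq_zero _).1 hinj b h, map_zero] at hb
    exact hb rfl
  obtain ⟨c, d, hd, hcd⟩ := IsOreDomain.left_ore (K.mapScalars O.subtype a) _ hb'
  obtain ⟨i₁, h₁⟩ := K.exists_ofCoords c
  obtain ⟨i₂, h₂⟩ := K.exists_ofCoords d
  obtain ⟨x, hx⟩ := h₁ _ (le_max_left i₁ i₂)
  obtain ⟨y, hy⟩ := h₂ _ (le_max_right i₁ i₂)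
  -- The two coordinate vectors are joined so that a single factor `r` rescales both and preserves
  -- the equation.
  have hxy : Sum.elim x y ≠ 0 := by
    intro h
    refine hd ?_
    rw [hy, show y = 0 from funext fun j => congrFun h (Sum.inr j)]
    simp [ofCoords]
  obtain ⟨r, hr, hrO, j₀, hj₀⟩ := exists_scaling O hxy
  let x' : K.FilIndex (max i₁ i₂) → O := fun j => ⟨r * x j, hrO (Sum.inl j)⟩
  let y' : K.FilIndex (max i₁ i₂) → O := fun j => ⟨r * y j, hrO (Sum.inr j)⟩
  have hsmul : ∀ (z : K.FilIndex (max i₁ i₂) → k) (z' : K.FilIndex (max i₁ i₂) → O),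
      (∀ j, (z' j : k) = r * z j) →
      K.mapScalars O.subtype (K.ofCoords z') = r • K.ofCoords z := by
    intro z z' hz
    rw [mapScalars_ofCoords, ofCoords, ofCoords, Finset.smul_sum]
    refine Finset.sum_congr rfl fun j _ => ?_
    rw [TensorProduct.smul_tmul', smul_eq_mul, ← hz]
    rfl
  have heq : K.ofCoords y' * a = K.ofCoords x' * b := by
    apply hinj
    rw [map_mul, map_mul, hsmul y y' fun _ => rfl, hsmul x x' fun _ => rfl, ← hx, ← hy,
      smul_mul_assoc, smul_mul_assoc, hcd]
  refine ⟨K.ofCoords x', K.ofCoords y', fun h0 => ?_, heq⟩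
  have h0' : K.mapScalars φ (K.ofCoords x') = 0 := by
    have := congrArg (K.mapScalars φ) heq
    rw [map_mul, map_mul, h0, zero_mul] at this
    exact (mul_eq_zero.1 this.symm).resolve_right hb
  rw [mapScalars_ofCoords] at h0 h0'
  have hx0 := not_not.1 (mt K.ofCoords_ne_zero (not_not.2 h0'))
  have hy0 := not_not.1 (mt K.ofCoords_ne_zero (not_not.2 h0))
  have key : ∀ z : O, (z : k) = 1 → φ z ≠ 0 := by
    intro z hz
    rw [show z = 1 from Subtype.ext hz, map_one]
    exact one_ne_zero
  rcases j₀ with j | j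
  · exact key (x' j) hj₀ (congrFun hx0 j)
  · exact key (y' j) hj₀ (congrFun hy0 j)

variable {D E : Type*} [DivisionRing D] [DivisionRing E] {i : K.alg k →+* D} {j : K.alg F →+* E}

/-- The graph of the specialization from `Frac A_k` to `Frac A_F` given by a homomorphism
from a valuation subring of `k` to `F`. -/
def spec (i : K.alg k →+* D) (hj : Function.Injective j) (O : ValuationSubring k) (φ : O →+* F) :
    Subring (D × E) :=
  specGraph (i.comp (K.mapScalars O.subtype)) (j.comp (K.mapScalars φ)) fun a b hb => by
    obtain ⟨c, d, hd, h⟩ := K.ore_condition_specialization O φ a b fun h0 => hb (by simp [h0])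
    exact ⟨c, d, ne_zero_of_injective hj hd, h⟩

theorem tmul_mem_spec (hj : Function.Injective j) (O : ValuationSubring k) (φ : O →+* F) (r : O)
    (a : K.ring) : (i ((r : k) ⊗ₜ a), j (φ r ⊗ₜ a)) ∈ K.spec i hj O φ :=
  mk_mem_specGraph (i := i.comp (K.mapScalars O.subtype)) (j := j.comp (K.mapScalars φ))
    (r ⊗ₜ[ℤ] a)

theorem eq_of_mem_spec (hi : Function.Injective i) {hj : Function.Injective j}
    {O : ValuationSubring k} {φ : O →+* F} {x : D} {y y' : E} (h : (x, y) ∈ K.spec i hj O φ)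
    (hxy : (x, y') ∈ K.spec i hj O φ) : y = y' :=
  eq_of_mem_specGraph (i := i.comp (K.mapScalars O.subtype))
    (hi.comp (K.mapScalars_injective Subtype.val_injective)) h hxy

/-- Every element of `Frac A_k` specializes, and to a nonzero element if it is nonzero itself, as
soon as the valuation subring contains a certain finite set. -/
theorem exists_mem_spec (hi : IsSkewFractionMap i) (q : D) :
    ∃ s : Finset k, ∀ (F : Type u) [Field F] [IsAlgClosed F] (E : Type (max u v)) [DivisionRing E]
      (j : K.alg F →+* E) (hj : Function.Injective j) (O : ValuationSubring k) (φ : O →+* F),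
      (s : Set k) ⊆ O → ∃ q', (q, q') ∈ K.spec i hj O φ ∧ (q ≠ 0 → q' ≠ 0) := by
  classical
  by_cases hq : q = 0
  · subst hq
    exact ⟨∅, fun F _ _ E _ j hj O φ _ => ⟨0, zero_mem _, fun h => absurd rfl h⟩⟩
  obtain ⟨a, s, hs, hsa⟩ := hi.2 q
  have ha : a ≠ 0 := by
    rintro rfl
    exact hq (by simpa using hsa)
  obtain ⟨t₁, h₁⟩ := K.exists_lift_of_ne_zero hs
  obtain ⟨t₂, h₂⟩ := K.exists_lift_of_ne_zero ha
  refine ⟨t₁ ∪ t₂, fun F _ _ E _ j hj O φ ht => ?_⟩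
  rw [Finset.coe_union, Set.union_subset_iff] at ht
  obtain ⟨s', hs', hs0⟩ := h₁ F O φ ht.1
  obtain ⟨a', ha', ha0⟩ := h₂ F O φ ht.2
  have hs1 := ne_zero_of_injective hj hs0
  have ha1 := ne_zero_of_injective hj ha0
  refine ⟨(j (K.mapScalars φ s'))⁻¹ * j (K.mapScalars φ a'), ⟨s', a', hs1, ?_, ?_⟩,
    fun _ => mul_ne_zero (inv_ne_zero hs1) ha1⟩
  · simp [hs', ha', hsa, mul_inv_cancel_left₀ (ne_zero_of_injective hi.1 hs)]
  · exact mul_inv_cancel_left₀ hs1 _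

end ZCompatibleFamily

/-! ### Growth of algebras whose generators have scalar commutators -/

section Words

variable (F : Type*) {E ι : Type*} [Field F] [Ring E] [Algebra F E] (w : ι → E)

/-- The product of the generators along a list. -/
def word (L : List ι) : E := (L.map w).prod

/-- The span of the words of length less than `m`. -/
def wordSpan (m : ℕ) : Submodule F E := Submodule.span F (word w '' {L | L.length < m})

/-- All commutators of the generators are scalars. -/
def ScalarCommutators : Prop := ∀ i j, ∃ c : F, w i * w j - w j * w i = algebraMap F E c

/-- A monomial in the generators, with the factors in some fixed order. -/
def mon (α : ι →₀ ℕ) : E := word w α.toMultiset.toList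

variable {F w}

theorem word_append (L L' : List ι) : word w (L ++ L') = word w L * word w L' := by
  simp [word]

theorem word_mem_wordSpan {L : List ι} {m : ℕ} (h : L.length < m) : word w L ∈ wordSpan F w m :=
  Submodule.subset_span ⟨L, h, rfl⟩

theorem wordSpan_mono : Monotone (wordSpan F w) := fun _ _ hmn =>
  Submodule.span_mono (Set.image_mono fun _ hL => lt_of_lt_of_le hL hmn)

theorem word_mul_mem (L : List ι) {m : ℕ} {x : E} (hx : x ∈ wordSpan F w m) :
    word w L * x ∈ wordSpan F w (L.length + m) := by
  induction hx using Submodule.span_induction with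
  | mem x hx =>
    obtain ⟨L', hL', rfl⟩ := hx
    rw [← word_append]
    exact word_mem_wordSpan (by rw [List.length_append]; exact Nat.add_lt_add_left hL' _)
  | zero => simp
  | add x y _ _ hx hy => rw [mul_add]; exact add_mem hx hy
  | smul c x _ hx => rw [mul_smul_comm]; exact Submodule.smul_mem _ _ hx

/-- With the strict length bound, index `m + 1` means length at most `m`; in this form lengths add.
-/
theorem wordSpan_mul_le (m n : ℕ) :
    wordSpan F w (m + 1) * wordSpan F w (n + 1) ≤ wordSpan F w (m + n + 1) := by
  rw [wordSpan, wordSpan, Submodule.span_mul_span, Submodule.span_le]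
  rintro _ ⟨_, ⟨L, hL, rfl⟩, _, ⟨L', hL', rfl⟩, rfl⟩
  dsimp only
  rw [← word_append]
  refine word_mem_wordSpan ?_
  rw [Set.mem_ofPred_eq] at hL hL'
  rw [List.length_append]
  omega

theorem wordSpan_pow_le (m n : ℕ) : wordSpan F w (m + 1) ^ n ≤ wordSpan F w (m * n + 1) := by
  induction n with
  | zero =>
    rw [pow_zero, Submodule.one_le]
    exact word_mem_wordSpan (L := []) (by simp)
  | succ n ih =>
    rw [pow_succ]
    exact (mul_le_mul' ih le_rfl).trans (wordSpan_mul_le _ _)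

/-- Exchanging two adjacent letters changes a word by a scalar multiple of a word shorter by two, so
letters commute modulo shorter words. -/
theorem word_sub_mem_of_perm (hw : ScalarCommutators F w) {L L' : List ι} (h : L.Perm L') :
    word w L - word w L' ∈ wordSpan F w L.length := by
  induction h with
  | nil => simp
  | @cons i L L' h ih =>
    have := word_mul_mem [i] ih
    simp only [word, List.map_cons, List.prod_cons, List.length_cons, ← mul_sub] at this ⊢
    simpa [add_comm] using this
  | swap i j L =>
    obtain ⟨c, hc⟩ := hw j i
    have : word w (j :: i :: L) - word w (i :: j :: L) = c • word w L := by
      rw [Algebra.smul_def, ← hc]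
      simp [word, sub_mul, mul_assoc]
    rw [this]
    exact Submodule.smul_mem _ _ (word_mem_wordSpan (by simp))
  | @trans L₁ L₂ L₃ h₁ h₂ ih₁ ih₂ =>
    rw [← h₁.length_eq] at ih₂
    simpa using add_mem ih₁ ih₂

theorem length_toList_toMultiset (α : ι →₀ ℕ) : α.toMultiset.toList.length = α.degree := by
  rw [Multiset.length_toList, Finsupp.card_toMultiset]
  rfl

theorem mon_zero : mon w 0 = 1 := by simp [mon, word]

theorem mon_mul_sub_mem (hw : ScalarCommutators F w) (α β : ι →₀ ℕ) :
    mon w α * mon w β - mon w (α + β) ∈ wordSpan F w (α + β).degree := by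
  have h : (α.toMultiset.toList ++ β.toMultiset.toList).Perm (α + β).toMultiset.toList := by
    rw [← Multiset.coe_eq_coe, ← Multiset.coe_add]
    simp
  have := word_sub_mem_of_perm hw h
  rwa [word_append, h.length_eq, length_toList_toMultiset] at this

theorem span_mon_mono {T T' : Set (ι →₀ ℕ)} (h : ∀ α ∈ T, α ∈ T') :
    Submodule.span F (mon w '' T) ≤ Submodule.span F (mon w '' T') :=
  Submodule.span_mono (Set.image_mono h)

theorem wordSpan_le_span_mon (hw : ScalarCommutators F w) (m : ℕ) :
    wordSpan F w m ≤ Submodule.span F (mon w '' {α | α.degree < m}) := by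
  classical
  induction m with
  | zero => simp [wordSpan]
  | succ m ih =>
    rw [wordSpan, Submodule.span_le]
    rintro _ ⟨L, hL, rfl⟩
    have h : L.Perm (Multiset.toFinsupp (L : Multiset ι)).toMultiset.toList := by
      rw [← Multiset.coe_eq_coe]
      simp
    have hdeg : (Multiset.toFinsupp (L : Multiset ι)).degree = L.length := by
      rw [← length_toList_toMultiset, h.length_eq]
    have h1 := word_sub_mem_of_perm hw h
    have hle : Submodule.span F (mon w '' {α | α.degree < m}) ≤
        Submodule.span F (mon w '' {α | α.degree < m + 1}) :=
      span_mon_mono fun α hα => Nat.lt_succ_of_lt hα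
    have h2 := hle (ih (wordSpan_mono (Nat.le_of_lt_succ hL) h1))
    rw [← sub_add_cancel (word w L) (mon w (Multiset.toFinsupp (L : Multiset ι)))]
    exact add_mem h2 (Submodule.subset_span ⟨_, by rw [Set.mem_ofPred_eq, hdeg]; exact hL, rfl⟩)

/-- If the monomials are linearly dependent, then one of them is a combination of smaller ones
in the degree-lexicographic order. -/
theorem exists_mon_mem_span_of_not_linearIndependent [LinearOrder ι]
    (h : ¬ LinearIndependent F (mon w)) :
    ∃ γ, mon w γ ∈ Submodule.span F (mon w '' {α | toDegLex α < toDegLex γ}) := by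
  rw [linearIndependent_iff] at h
  push Not at h
  obtain ⟨g, hg, hg0⟩ := h
  obtain ⟨γ, hγ, hmax⟩ := Finset.exists_max_image g.support toDegLex
    (Finsupp.support_nonempty_iff.2 hg0)
  refine ⟨γ, ?_⟩
  have hγ0 : g γ ≠ 0 := Finsupp.mem_support_iff.1 hγ
  rw [Finsupp.linearCombination_apply, Finsupp.sum, ← Finset.add_sum_erase _ _ hγ,
    add_eq_zero_iff_eq_neg] at hg
  rw [← inv_smul_smul₀ hγ0 (mon w γ), hg]
  refine Submodule.smul_mem _ _ (neg_mem (sum_mem fun α hα => Submodule.smul_mem _ _ ?_))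
  refine Submodule.subset_span ⟨α, ?_, rfl⟩
  rw [Finset.mem_erase] at hα
  exact lt_of_le_of_ne (hmax α hα.2) fun h => hα.1 (toDegLex_injective h)

/-- This is Gröbner reduction by one relation with leading exponent `γ`. Modulo lower degree, the
monomial of `γ + δ` is the product of those of `γ` and `δ`; rewriting the first factor yields
smaller monomials, as the order is compatible with addition. A degree-first order preserves the
degree bound needed for counting. -/
theorem mon_mem_span_not_le [LinearOrder ι] [Finite ι] (hw : ScalarCommutators F w) {γ : ι →₀ ℕ}
    (hγ : mon w γ ∈ Submodule.span F (mon w '' {α | toDegLex α < toDegLex γ})) (α : ι →₀ ℕ) :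
    mon w α ∈ Submodule.span F (mon w '' {β | ¬ γ ≤ β ∧ β.degree ≤ α.degree}) := by
  have wf : WellFounded ((· < ·) : DegLex (ι →₀ ℕ) → DegLex (ι →₀ ℕ) → Prop) := wellFounded_lt
  induction α using WellFounded.induction (InvImage.wf toDegLex wf) with
  | _ α ih =>
  have hmono : ∀ β, toDegLex β < toDegLex α →
      mon w β ∈ Submodule.span F (mon w '' {β | ¬ γ ≤ β ∧ β.degree ≤ α.degree}) := by
    intro β hβ
    have hd : β.degree ≤ α.degree := Finsupp.DegLex.monotone_degree hβ.le
    refine (show Submodule.span F (mon w '' _) ≤ _ from span_mon_mono ?_) (ih β hβ)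
    exact fun δ hδ => ⟨hδ.1, hδ.2.trans hd⟩
  have hlow : wordSpan F w α.degree ≤
      Submodule.span F (mon w '' {β | ¬ γ ≤ β ∧ β.degree ≤ α.degree}) := by
    refine (wordSpan_le_span_mon hw _).trans (Submodule.span_le.2 ?_)
    rintro _ ⟨β, hβ, rfl⟩
    exact hmono β (Finsupp.DegLex.lt_iff.2 (Or.inl hβ))
  by_cases hα : γ ≤ α
  · obtain ⟨δ, rfl⟩ := exists_add_of_le hα
    have h1 := hlow (mon_mul_sub_mem hw γ δ)
    rw [← sub_sub_cancel (mon w γ * mon w δ) (mon w (γ + δ))]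
    refine sub_mem ?_ h1
    have h2 : ∀ x ∈ Submodule.span F (mon w '' {α | toDegLex α < toDegLex γ}), x * mon w δ ∈
        Submodule.span F (mon w '' {β | ¬ γ ≤ β ∧ β.degree ≤ (γ + δ).degree}) := by
      intro x hx
      induction hx using Submodule.span_induction with
      | mem x hx =>
        obtain ⟨β, hβ, rfl⟩ := hx
        have hlt : toDegLex (β + δ) < toDegLex (γ + δ) := by
          rw [toDegLex_add, toDegLex_add]
          exact add_lt_add_left hβ _
        have h3 := hlow (wordSpan_mono (Finsupp.DegLex.monotone_degree hlt.le)
          (mon_mul_sub_mem hw β δ))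
        rw [← sub_add_cancel (mon w β * mon w δ) (mon w (β + δ))]
        exact add_mem h3 (hmono _ hlt)
      | zero => simp
      | add x y _ _ hx hy => rw [add_mul]; exact add_mem hx hy
      | smul c x _ hx => rw [smul_mul_assoc]; exact Submodule.smul_mem _ _ hx
    exact h2 _ hγ
  · exact Submodule.subset_span ⟨α, ⟨hα, le_rfl⟩, rfl⟩

variable [Fintype ι]

theorem finite_wordSpan (m : ℕ) : Module.Finite F (wordSpan F w m) := by
  refine Module.Finite.span_of_finite F (Set.Finite.image _ ?_)
  exact List.finite_length_lt ι m

/-- A subspace spanned by monomials with exponents in a finite set has dimension at most the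
size of that set. -/
theorem finrank_le_of_le_span_mon {S : Submodule F E} {T : Set (ι →₀ ℕ)} {t : Finset (ι → ℕ)}
    (hT : ∀ α ∈ T, ⇑α ∈ t) (hS : S ≤ Submodule.span F (mon w '' T)) :
    Module.finrank F S ≤ t.card := by
  classical
  let t' : Finset E := t.image fun f => mon w (Finsupp.equivFunOnFinite.symm f)
  have hle : S ≤ Submodule.span F (t' : Set E) := by
    refine hS.trans (Submodule.span_mono ?_)
    rintro _ ⟨α, hα, rfl⟩
    rw [Finset.mem_coe, Finset.mem_image]
    exact ⟨α, hT α hα, congrArg (mon w) (Finsupp.equivFunOnFinite.symm_apply_apply α)⟩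
  exact (Submodule.finrank_mono hle).trans
    ((finrank_span_finset_le_card t').trans Finset.card_image_le)

theorem finrank_wordSpan_le (hw : ScalarCommutators F w) (m : ℕ) :
    Module.finrank F (wordSpan F w m) ≤ m ^ Fintype.card ι := by
  classical
  refine (finrank_le_of_le_span_mon (t := Fintype.piFinset fun _ => Finset.range m) ?_
    (wordSpan_le_span_mon hw m)).trans_eq (by simp)
  intro α hα
  rw [Fintype.mem_piFinset]
  exact fun i => Finset.mem_range.2 ((Finsupp.le_degree i α).trans_lt hα)

/-- If the monomials are linearly dependent, then the growth is of degree less than the number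
of generators. -/
theorem exists_finrank_wordSpan_le_of_not_linearIndependent [Nontrivial E]
    (hw : ScalarCommutators F w) (h : ¬ LinearIndependent F (mon w)) :
    0 < Fintype.card ι ∧
      ∃ C, ∀ m, Module.finrank F (wordSpan F w m) ≤ C * m ^ (Fintype.card ι - 1) := by
  classical
  let : LinearOrder ι := LinearOrder.lift' (Fintype.equivFin ι) (Fintype.equivFin ι).injective
  obtain ⟨γ, hγ⟩ := exists_mon_mem_span_of_not_linearIndependent h
  -- Nothing is smaller than `0`, so `γ = 0` would put `1` in the zero subspace.
  have hγ0 : γ ≠ 0 := by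
    rintro rfl
    have : {α : ι →₀ ℕ | toDegLex α < toDegLex 0} = ∅ := by
      ext α
      simp only [Set.mem_ofPred_eq, Set.mem_empty_iff_false, iff_false, not_lt]
      exact bot_le (α := DegLex (ι →₀ ℕ))
    rw [this, mon_zero] at hγ
    simp at hγ
  refine ⟨?_, γ.degree, fun m => ?_⟩
  · by_contra h0
    have := Fintype.card_eq_zero_iff.1 (Nat.eq_zero_of_not_pos h0)
    exact hγ0 (Subsingleton.elim _ _)
  have hle : wordSpan F w m ≤ Submodule.span F (mon w '' {β | ¬ γ ≤ β ∧ β.degree < m}) := by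
    refine (wordSpan_le_span_mon hw m).trans (Submodule.span_le.2 ?_)
    rintro _ ⟨α, hα, rfl⟩
    refine (show Submodule.span F (mon w '' _) ≤ _ from span_mon_mono ?_)
      (mon_mem_span_not_le hw hγ α)
    exact fun β hβ => ⟨hβ.1, hβ.2.trans_lt hα⟩
  -- If `γ ≤ β` fails, then `β i < γ i` for some `i`, while the other exponents are below `m`.
  -- Counting these slabs gives the sum of the `γ i`, that is `γ.degree`, times the power of `m`.
  refine (finrank_le_of_le_span_mon (t := Finset.univ.biUnion fun i =>
    Fintype.piFinset fun j => Finset.range (if j = i then γ i else m)) ?_ hle).trans ?_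
  · rintro α ⟨hα, hd⟩
    obtain ⟨i, hi⟩ := not_forall.1 hα
    rw [Finset.mem_biUnion]
    refine ⟨i, Finset.mem_univ _, Fintype.mem_piFinset.2 fun j => Finset.mem_range.2 ?_⟩
    split_ifs with hj
    · subst hj; exact not_le.1 hi
    · exact (Finsupp.le_degree j α).trans_lt hd
  · refine Finset.card_biUnion_le.trans_eq ?_
    rw [Finsupp.degree_eq_sum, Finset.sum_mul]
    refine Finset.sum_congr rfl fun i _ => ?_
    rw [Fintype.card_piFinset, ← Finset.mul_prod_erase _ _ (Finset.mem_univ i)]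
    simp only [Finset.card_range, if_true]
    rw [Finset.prod_congr rfl fun j hj => if_neg (Finset.ne_of_mem_erase hj), Finset.prod_const,
      Finset.card_erase_of_mem (Finset.mem_univ i), Finset.card_univ]

end Words

/-! ### Gelfand–Kirillov dimension and fractions -/

section Adjoin

variable {F E ι : Type*} [Field F] [Ring E] [Algebra F E] {w : ι → E}

theorem mem_adjoin_of_mem_wordSpan {m : ℕ} {x : E} (hx : x ∈ wordSpan F w m) :
    x ∈ Algebra.adjoin F (Set.range w) := by
  have : wordSpan F w m ≤ Subalgebra.toSubmodule (Algebra.adjoin F (Set.range w)) := by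
    refine Submodule.span_le.2 ?_
    rintro _ ⟨L, -, rfl⟩
    refine Subalgebra.list_prod_mem _ fun y hy => ?_
    obtain ⟨i, -, rfl⟩ := List.mem_map.1 hy
    exact Algebra.subset_adjoin ⟨i, rfl⟩
  exact this hx

theorem exists_mem_wordSpan_of_mem_adjoin {x : E} (hx : x ∈ Algebra.adjoin F (Set.range w)) :
    ∃ m, x ∈ wordSpan F w (m + 1) := by
  induction hx using Algebra.adjoin_induction with
  | mem x hx =>
    obtain ⟨i, rfl⟩ := hx
    have : word w [i] ∈ wordSpan F w 2 := word_mem_wordSpan (by simp)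
    exact ⟨1, by simpa [word] using this⟩
  | algebraMap r =>
    refine ⟨0, ?_⟩
    rw [Algebra.algebraMap_eq_smul_one]
    exact Submodule.smul_mem _ _ (word_mem_wordSpan (L := []) (by simp))
  | add x y _ _ hx hy =>
    obtain ⟨m, hm⟩ := hx
    obtain ⟨n, hn⟩ := hy
    exact ⟨max m n, add_mem (wordSpan_mono (by omega) hm) (wordSpan_mono (by omega) hn)⟩
  | mul x y _ _ hx hy =>
    obtain ⟨m, hm⟩ := hx
    obtain ⟨n, hn⟩ := hy
    exact ⟨m + n, wordSpan_mul_le m n (Submodule.mul_mem_mul hm hn)⟩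

theorem exists_le_wordSpan_of_fg {V : Submodule F E} (hV : V.FG)
    (hle : (V : Set E) ⊆ Algebra.adjoin F (Set.range w)) : ∃ m, V ≤ wordSpan F w (m + 1) := by
  classical
  obtain ⟨s, rfl⟩ := hV
  choose! f hf using fun x (hx : x ∈ s) =>
    exists_mem_wordSpan_of_mem_adjoin (hle (Submodule.subset_span hx))
  refine ⟨s.sup f, Submodule.span_le.2 fun x hx => wordSpan_mono ?_ (hf x hx)⟩
  exact Nat.succ_le_succ (Finset.le_sup hx)

theorem limsup_log_le {a : ℕ → ℕ} {C d : ℕ} (h : ∀ n, 1 ≤ n → a n ≤ C * n ^ d) :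
    Filter.limsup (fun n : ℕ => ((Real.log (a n) / Real.log n : ℝ) : EReal)) Filter.atTop ≤
      (d : EReal) := by
  -- `C + 1` replaces `C` so that the logarithm behaves also for `C = 0`.
  have hlim : Filter.Tendsto (fun n : ℕ => ((Real.log (C + 1) / Real.log n + d : ℝ) : EReal))
      Filter.atTop (nhds ((d : ℝ) : EReal)) := by
    refine (continuous_coe_real_ereal.tendsto _).comp ?_
    have h1 : Filter.Tendsto (fun n : ℕ => Real.log (C + 1) / Real.log n) Filter.atTop (nhds 0) :=
      Filter.Tendsto.div_atTop tendsto_const_nhds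
        (Real.tendsto_log_atTop.comp tendsto_natCast_atTop_atTop)
    simpa using h1.add_const (d : ℝ)
  have hle : (fun n : ℕ => ((Real.log (a n) / Real.log n : ℝ) : EReal)) ≤ᶠ[Filter.atTop]
      fun n : ℕ => ((Real.log (C + 1) / Real.log n + d : ℝ) : EReal) := by
    filter_upwards [Filter.eventually_ge_atTop 2] with n hn
    have hn1 : (1 : ℝ) < n := by exact_mod_cast hn
    have hlog : 0 < Real.log n := Real.log_pos hn1
    have hn0 : (0 : ℝ) < (n : ℝ) ^ d := by positivity
    rw [EReal.coe_le_coe_iff, div_add' _ _ _ hlog.ne']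
    refine div_le_div_of_nonneg_right ?_ hlog.le
    rw [← Real.log_pow, ← Real.log_mul (by positivity) hn0.ne']
    rcases Nat.eq_zero_or_pos (a n) with h0 | h0
    · rw [h0, Nat.cast_zero, Real.log_zero]
      refine Real.log_nonneg ?_
      have : (1 : ℝ) ≤ (n : ℝ) ^ d := one_le_pow₀ hn1.le
      nlinarith [(Nat.cast_nonneg C : (0 : ℝ) ≤ C)]
    · refine Real.log_le_log (by exact_mod_cast h0) ?_
      have h1 : (a n : ℝ) ≤ C * (n : ℝ) ^ d := by exact_mod_cast h n (by omega)
      nlinarith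
  refine (Filter.limsup_le_limsup hle).trans_eq ?_
  rw [hlim.limsup_eq]
  rfl

/-- A finite-dimensional subspace consists of words of length at most some `e`, so its `n`-th power
uses length at most `e n`. Passing to other generators, or to a subalgebra, costs only a constant
factor. -/
theorem gkDim_le_of_finrank_wordSpan_le [Finite ι] {C d : ℕ}
    (h : ∀ m, Module.finrank F (wordSpan F w m) ≤ C * m ^ d) {S : Subalgebra F E}
    (hS : S ≤ Algebra.adjoin F (Set.range w)) : gkDim F S ≤ (d : EReal) := by
  cases nonempty_fintype ι
  refine iSup₂_le fun W hW => ?_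
  obtain ⟨e, he⟩ := exists_le_wordSpan_of_fg (w := w) (hW.map S.val.toLinearMap) (by
    rintro _ ⟨x, -, rfl⟩
    exact hS x.2)
  refine limsup_log_le (C := C * (e + 1) ^ d) fun n hn => ?_
  have hmap : ((1 ⊔ W) ^ n).map S.val.toLinearMap ≤ wordSpan F w (e * n + 1) := by
    rw [Submodule.map_pow]
    refine (pow_le_pow_left' ?_ n).trans (wordSpan_pow_le e n)
    rw [Submodule.map_sup, Submodule.map_one, sup_le_iff]
    refine ⟨?_, he⟩
    rw [Submodule.one_le]
    exact word_mem_wordSpan (L := []) (by simp)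
  have := finite_wordSpan (F := F) (w := w) (e * n + 1)
  have hfr : Module.finrank F ((1 ⊔ W) ^ n : Submodule F S) ≤
      Module.finrank F (wordSpan F w (e * n + 1)) := by
    rw [(Submodule.equivMapOfInjective S.val.toLinearMap Subtype.val_injective _).finrank_eq]
    exact Submodule.finrank_mono hmap
  refine hfr.trans ((h _).trans ?_)
  rw [mul_assoc, ← mul_pow]
  exact Nat.mul_le_mul_left _ (Nat.pow_le_pow_left (by nlinarith) _)

end Adjoin

/-! ### Fractions of an algebra of polynomial growth inside a skew field -/

section Fractions

variable {F E ι : Type*} [Field F] [DivisionRing E] [Algebra F E] {w : ι → E}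

theorem exists_pow_lt_two_pow (e d : ℕ) : ∃ m : ℕ, (m * e + 1) ^ d < 2 ^ m := by
  have h1 := tendsto_pow_const_div_const_pow_of_one_lt d (r := 2) one_lt_two
  have hpos : (0 : ℝ) < 1 / (e + 1) ^ d := by positivity
  obtain ⟨m, hm, hm1⟩ := ((h1.eventually_lt_const hpos).and
    (Filter.eventually_ge_atTop 1)).exists
  refine ⟨m, ?_⟩
  rw [div_lt_div_iff₀ (by positivity) (by positivity), one_mul, ← mul_pow] at hm
  have : (m * (e + 1)) ^ d < 2 ^ m := by exact_mod_cast hm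
  refine lt_of_le_of_lt (Nat.pow_le_pow_left ?_ d) this
  nlinarith

/-- The algebra generated by `w` satisfies the left Ore condition. -/
theorem adjoin_left_ore [Fintype ι] (hw : ScalarCommutators F w) {a b : E}
    (ha : a ∈ Algebra.adjoin F (Set.range w)) (hb : b ∈ Algebra.adjoin F (Set.range w))
    (hb0 : b ≠ 0) :
    ∃ c ∈ Algebra.adjoin F (Set.range w), ∃ d ∈ Algebra.adjoin F (Set.range w),
      d ≠ 0 ∧ d * a = c * b := by
  by_contra! hne
  obtain ⟨e₁, h₁⟩ := exists_mem_wordSpan_of_mem_adjoin ha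
  obtain ⟨e₂, h₂⟩ := exists_mem_wordSpan_of_mem_adjoin hb
  set e := max e₁ e₂
  replace h₁ : a ∈ wordSpan F w (e + 1) := wordSpan_mono (by omega) h₁
  replace h₂ : b ∈ wordSpan F w (e + 1) := wordSpan_mono (by omega) h₂
  have hfin := finite_wordSpan (F := F) (w := w)
  -- Without a common left multiple, `(d, c) ↦ d a - c b` is injective. The dimension then doubles
  -- with every `e` letters, against polynomial growth.
  have hdouble : ∀ m, 2 * Module.finrank F (wordSpan F w (m + 1)) ≤
      Module.finrank F (wordSpan F w (m + e + 1)) := by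
    intro m
    let f : (wordSpan F w (m + 1) × wordSpan F w (m + 1)) →ₗ[F] E :=
      ((LinearMap.mulRight F a).comp (wordSpan F w (m + 1)).subtype).coprod
        (-((LinearMap.mulRight F b).comp (wordSpan F w (m + 1)).subtype))
    have hf : ∀ x, f x = x.1 * a - x.2 * b := fun x => by simp [f, sub_eq_add_neg]
    have hfmem : ∀ x, f x ∈ wordSpan F w (m + e + 1) := fun x => by
      rw [hf]
      exact sub_mem (wordSpan_mul_le m e (Submodule.mul_mem_mul x.1.2 h₁))
        (wordSpan_mul_le m e (Submodule.mul_mem_mul x.2.2 h₂))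
    have hinj : Function.Injective (f.codRestrict _ hfmem) := by
      rw [injective_iff_map_eq_zero]
      rintro ⟨⟨d, hd⟩, ⟨c, hc⟩⟩ h0
      have h0' : d * a - c * b = 0 := by rw [← hf (⟨d, hd⟩, ⟨c, hc⟩)]; exact congrArg Subtype.val h0
      have hd0 : d = 0 := by
        by_contra hd0
        exact hne c (mem_adjoin_of_mem_wordSpan hc) d (mem_adjoin_of_mem_wordSpan hd) hd0
          (sub_eq_zero.1 h0')
      subst hd0
      have hc0 : c = 0 := by simpa [hb0] using h0'
      subst hc0
      rfl
    have := LinearMap.finrank_le_finrank_of_injective hinj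
    rw [Module.finrank_prod] at this
    omega
  have hpow : ∀ m, 2 ^ m ≤ Module.finrank F (wordSpan F w (m * e + 1)) := by
    intro m
    induction m with
    | zero =>
      have : (1 : E) ∈ wordSpan F w (0 * e + 1) := word_mem_wordSpan (L := []) (by simp)
      rw [pow_zero, Nat.one_le_iff_ne_zero]
      intro h0
      have h1 := Submodule.finrank_eq_zero.1 h0
      rw [h1, Submodule.mem_bot] at this
      exact one_ne_zero this
    | succ m ih =>
      rw [pow_succ, mul_comm, Nat.succ_mul m e]
      exact (Nat.mul_le_mul_left 2 ih).trans (hdouble _)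
  obtain ⟨m, hm⟩ := exists_pow_lt_two_pow e (Fintype.card ι)
  exact absurd ((hpow m).trans (finrank_wordSpan_le hw _)) (not_le.2 hm)

/-- The left fractions `b⁻¹ c` of the algebra generated by `w` form a subring. -/
def fractions [Fintype ι] (hw : ScalarCommutators F w) : Subring E :=
  -- With both homomorphisms equal to the inclusion, the diagonal part of the graph is exactly the
  -- set of fractions.
  (specGraph (Algebra.adjoin F (Set.range w)).val.toRingHom
    (Algebra.adjoin F (Set.range w)).val.toRingHom fun a b hb => by
      obtain ⟨c, hc, d, hd, hd0, h⟩ := adjoin_left_ore hw a.2 b.2 hb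
      exact ⟨⟨c, hc⟩, ⟨d, hd⟩, hd0, Subtype.ext h⟩).comap
    ((RingHom.id E).prod (RingHom.id E))

theorem mem_fractions [Fintype ι] {hw : ScalarCommutators F w} {q : E} :
    q ∈ fractions hw ↔ ∃ b ∈ Algebra.adjoin F (Set.range w),
      ∃ c ∈ Algebra.adjoin F (Set.range w), b ≠ 0 ∧ b * q = c := by
  constructor
  · rintro ⟨b, c, hb, h, -⟩
    exact ⟨b, b.2, c, c.2, hb, h⟩
  · rintro ⟨b, hb, c, hc, hb0, h⟩
    exact ⟨⟨b, hb⟩, ⟨c, hc⟩, hb0, h, h⟩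

theorem mem_fractions_of_mem_adjoin [Fintype ι] {hw : ScalarCommutators F w} {q : E}
    (hq : q ∈ Algebra.adjoin F (Set.range w)) : q ∈ fractions hw :=
  mem_fractions.2 ⟨1, one_mem _, q, hq, one_ne_zero, one_mul q⟩

theorem inv_mem_fractions [Fintype ι] {hw : ScalarCommutators F w} {q : E}
    (hq : q ∈ fractions hw) : q⁻¹ ∈ fractions hw := by
  rcases eq_or_ne q 0 with rfl | hq0
  · rwa [inv_zero]
  obtain ⟨b, hb, c, hc, hb0, h⟩ := mem_fractions.1 hq
  refine mem_fractions.2 ⟨c, hc, b, hb, ?_, ?_⟩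
  · rw [← h]; exact mul_ne_zero hb0 hq0
  · rw [← h, mul_inv_cancel_right₀ hq0]

theorem exists_common_denominator [Fintype ι] (hw : ScalarCommutators F w) (s : Finset E)
    (hs : ∀ q ∈ s, q ∈ fractions hw) :
    ∃ b ∈ Algebra.adjoin F (Set.range w), b ≠ 0 ∧
      ∀ q ∈ s, b * q ∈ Algebra.adjoin F (Set.range w) := by
  classical
  induction s using Finset.induction_on with
  | empty => exact ⟨1, one_mem _, one_ne_zero, by simp⟩
  | insert q s _ ih =>
    obtain ⟨b, hb, hb0, h⟩ := ih fun q hq => hs q (Finset.mem_insert_of_mem hq)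
    obtain ⟨b', hb', c', hc', hb'0, h'⟩ := mem_fractions.1 (hs q (Finset.mem_insert_self _ _))
    obtain ⟨c, hc, d, hd, hd0, hcd⟩ := adjoin_left_ore hw hb hb' hb'0
    refine ⟨d * b, mul_mem hd hb, mul_ne_zero hd0 hb0, fun r hr => ?_⟩
    rcases Finset.mem_insert.1 hr with rfl | hr
    · rw [hcd, mul_assoc, h']
      exact mul_mem hc hc'
    · rw [mul_assoc]
      exact mul_mem hd (h r hr)

/-- A common left denominator `b` of a basis of `V` moves `bV` into the algebra generated by `w`;
this one `b` already bounds the infimum. -/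
theorem tdeg_le_of_finrank_wordSpan_le [Fintype ι] (hw : ScalarCommutators F w)
    (htop : fractions hw = ⊤) {C d : ℕ}
    (h : ∀ m, Module.finrank F (wordSpan F w m) ≤ C * m ^ d) : tdeg F E ≤ (d : EReal) := by
  refine iSup₂_le fun V hV => ?_
  obtain ⟨s, rfl⟩ := hV
  obtain ⟨b, -, hb0, hb⟩ := exists_common_denominator hw s fun q _ => htop ▸ Subring.mem_top q
  refine iInf₂_le_of_le b (mem_nonZeroDivisors_of_ne_zero hb0) ?_
  refine gkDim_le_of_finrank_wordSpan_le h (Algebra.adjoin_le ?_)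
  rintro _ ⟨v, hv, rfl⟩
  dsimp only
  induction hv using Submodule.span_induction with
  | mem x hx => exact hb x hx
  | zero => simp
  | add x y _ _ hx hy => rw [mul_add]; exact add_mem hx hy
  | smul c x _ hx => rw [mul_smul_comm]; exact Subalgebra.smul_mem _ hx c

/-- If the skew field `E` consists of the fractions of the algebra generated by `w` and its
transcendence degree is the number of generators, then the monomials are linearly independent. -/
theorem linearIndependent_mon_of_tdeg [Fintype ι] (hw : ScalarCommutators F w)
    (htop : fractions hw = ⊤) (ht : tdeg F E = (Fintype.card ι : EReal)) :
    LinearIndependent F (mon w) := by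
  by_contra h
  obtain ⟨hpos, C, hC⟩ := exists_finrank_wordSpan_le_of_not_linearIndependent hw h
  have hle := tdeg_le_of_finrank_wordSpan_le hw htop hC
  rw [ht, Nat.cast_le] at hle
  omega

end Fractions

/-! ### Systems of Weyl generators -/

/-- The index set of the generators `x_i`, `y_i` and `t_j` of a Weyl field. -/
abbrev WeylIndex (n l : ℕ) : Type := (Fin n ⊕ Fin n) ⊕ Fin l

/-- The family `w`, consisting of elements `x_i`, `y_i` and `t_j`, satisfies the relations of the
generators of the Weyl algebra over `k[t_1, …, t_l]`. -/
structure IsWeylSystem {n l : ℕ} {E : Type*} [Ring E] (w : WeylIndex n l → E) : Prop where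
  x_comm : ∀ i j, w (.inl (.inl i)) * w (.inl (.inl j)) = w (.inl (.inl j)) * w (.inl (.inl i))
  y_comm : ∀ i j, w (.inl (.inr i)) * w (.inl (.inr j)) = w (.inl (.inr j)) * w (.inl (.inr i))
  y_x : ∀ i j, w (.inl (.inr i)) * w (.inl (.inl j)) =
    w (.inl (.inl j)) * w (.inl (.inr i)) + if i = j then 1 else 0
  t_comm : ∀ j a, w (.inr j) * w a = w a * w (.inr j)

namespace IsWeylSystem

variable {n l : ℕ} {E E' : Type*} [Ring E] [Ring E'] {w : WeylIndex n l → E}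

theorem map (hw : IsWeylSystem w) (f : E →+* E') : IsWeylSystem (f ∘ w) where
  x_comm i j := by simpa using congrArg f (hw.x_comm i j)
  y_comm i j := by simpa using congrArg f (hw.y_comm i j)
  y_x i j := by simpa [apply_ite f] using congrArg f (hw.y_x i j)
  t_comm j a := by simpa using congrArg f (hw.t_comm j a)

theorem of_map {f : E →+* E'} (hf : Function.Injective f) (hw : IsWeylSystem (f ∘ w)) :
    IsWeylSystem w where
  x_comm i j := hf (by simpa using hw.x_comm i j)
  y_comm i j := hf (by simpa using hw.y_comm i j)
  y_x i j := hf (by simpa [apply_ite f] using hw.y_x i j)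
  t_comm j a := hf (by simpa using hw.t_comm j a)

theorem scalarCommutators (hw : IsWeylSystem w) (F : Type*) [Field F] [Algebra F E] :
    ScalarCommutators F w := by
  have hc {a b} (h : w a * w b = w b * w a) : ∃ c : F, w a * w b - w b * w a = algebraMap F E c :=
    ⟨0, by rw [h, sub_self, map_zero]⟩
  rintro ((i | i) | i) ((j | j) | j)
  · exact hc (hw.x_comm i j)
  · exact ⟨if j = i then -1 else 0, by rw [hw.y_x]; split_ifs <;> simp⟩
  · exact hc (hw.t_comm j _).symm
  · exact ⟨if i = j then 1 else 0, by rw [hw.y_x]; split_ifs <;> simp⟩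
  · exact hc (hw.y_comm i j)
  · exact hc (hw.t_comm j _).symm
  all_goals exact hc (hw.t_comm i _)

end IsWeylSystem

section WeylGen

variable (k : Type u) [Field k] (n l : ℕ)

/-- The generators `x_i`, `y_i` and `t_j` of `A_n(k(t_1, …, t_l))`. -/
def weylGen : WeylIndex n l → WeylAlgebra (RatFun k l) n
  | .inl a => RingQuot.mkAlgHom (RatFun k l) (WeylRel (RatFun k l) n) (FreeAlgebra.ι _ a)
  | .inr j => algebraMap (RatFun k l) _ (algebraMap (MvPolynomial (Fin l) k) _ (MvPolynomial.X j))

theorem isWeylSystem_weylGen : IsWeylSystem (weylGen k n l) where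
  x_comm i j := by
    have := RingQuot.mkAlgHom_rel (RatFun k l) (WeylRel.x_comm (K := RatFun k l) (n := n) i j)
    rw [map_mul, map_mul] at this
    exact this
  y_comm i j := by
    have := RingQuot.mkAlgHom_rel (RatFun k l) (WeylRel.y_comm (K := RatFun k l) (n := n) i j)
    rw [map_mul, map_mul] at this
    exact this
  y_x i j := by
    have := RingQuot.mkAlgHom_rel (RatFun k l) (WeylRel.y_x (K := RatFun k l) (n := n) i j)
    rw [map_mul, map_add, map_mul, apply_ite (RingQuot.mkAlgHom _ _), map_one, map_zero] at this
    exact this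
  t_comm j a := Algebra.commutes _ _

variable {k n l}

theorem algebraMap_mem_adjoin_weylGen (h : MvPolynomial (Fin l) k) :
    algebraMap (RatFun k l) (WeylAlgebra (RatFun k l) n) (algebraMap _ _ h) ∈
      Algebra.adjoin k (Set.range (weylGen k n l)) := by
  induction h using MvPolynomial.induction_on with
  | C a =>
    have : algebraMap (RatFun k l) (WeylAlgebra (RatFun k l) n)
        (algebraMap (MvPolynomial (Fin l) k) _ (MvPolynomial.C a)) = algebraMap k _ a := by
      rw [← MvPolynomial.algebraMap_eq, ← IsScalarTower.algebraMap_apply k _ (RatFun k l),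
        ← IsScalarTower.algebraMap_apply k (RatFun k l)]
    rw [this]
    exact algebraMap_mem _ a
  | add p q hp hq => rw [map_add, map_add]; exact add_mem hp hq
  | mul_X p j hp =>
    rw [map_mul, map_mul]
    exact mul_mem hp (Algebra.subset_adjoin ⟨.inr j, rfl⟩)

/-- Only the denominators of scalars in `k(t_1, …, t_l)` are missing from the `k`-algebra of the
generators, and these are central, so they can be cleared. -/
theorem exists_smul_mem_adjoin_weylGen (z : WeylAlgebra (RatFun k l) n) :
    ∃ h : MvPolynomial (Fin l) k, h ≠ 0 ∧ (algebraMap _ (RatFun k l) h) • z ∈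
      Algebra.adjoin k (Set.range (weylGen k n l)) := by
  obtain ⟨z, rfl⟩ := RingQuot.mkAlgHom_surjective (RatFun k l) (WeylRel (RatFun k l) n) z
  induction z using FreeAlgebra.induction with
  | grade0 r =>
    obtain ⟨a, s, hs, rfl⟩ := IsFractionRing.div_surjective (A := MvPolynomial (Fin l) k) r
    refine ⟨s, nonZeroDivisors.ne_zero hs, ?_⟩
    have hs0 : algebraMap _ (RatFun k l) s ≠ 0 :=
      IsFractionRing.to_map_ne_zero_of_mem_nonZeroDivisors hs
    rw [AlgHom.commutes, Algebra.smul_def, ← map_mul, mul_div_cancel₀ _ hs0]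
    exact algebraMap_mem_adjoin_weylGen a
  | grade1 a =>
    refine ⟨1, one_ne_zero, ?_⟩
    rw [map_one, one_smul]
    exact Algebra.subset_adjoin ⟨.inl a, rfl⟩
  | mul a b ha hb =>
    obtain ⟨p, hp, ha⟩ := ha
    obtain ⟨q, hq, hb⟩ := hb
    refine ⟨p * q, mul_ne_zero hp hq, ?_⟩
    rw [map_mul, map_mul, ← smul_mul_smul_comm]
    exact mul_mem ha hb
  | add a b ha hb =>
    obtain ⟨p, hp, ha⟩ := ha
    obtain ⟨q, hq, hb⟩ := hb
    refine ⟨p * q, mul_ne_zero hp hq, ?_⟩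
    rw [map_add, smul_add]
    refine add_mem ?_ ?_
    · rw [mul_comm, map_mul, mul_smul, Algebra.smul_def]
      exact mul_mem (algebraMap_mem_adjoin_weylGen q) ha
    · rw [map_mul, mul_smul, Algebra.smul_def]
      exact mul_mem (algebraMap_mem_adjoin_weylGen p) hb

theorem smul_ne_zero_of_ne_zero {h : MvPolynomial (Fin l) k} (hh : h ≠ 0)
    {z : WeylAlgebra (RatFun k l) n} (hz : z ≠ 0) : (algebraMap _ (RatFun k l) h) • z ≠ 0 := by
  have h0 : algebraMap _ (RatFun k l) h ≠ 0 :=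
    (map_ne_zero_iff _ (IsFractionRing.injective _ _)).2 hh
  exact fun h1 => hz (by rw [← inv_smul_smul₀ h0 z, h1, smul_zero])

/-- Every element of a skew field of fractions of `A_n(k(t_1, …, t_l))` is a fraction of
elements of the `k`-subalgebra generated by the standard generators. -/
theorem exists_fraction_adjoin_weylGen {D : Type*} [DivisionRing D] [Algebra k D]
    {f : WeylAlgebra (RatFun k l) n →ₐ[k] D} (hf : IsSkewFractionMap f.toRingHom) (q : D) :
    ∃ b ∈ Algebra.adjoin k (Set.range (f ∘ weylGen k n l)),
      ∃ c ∈ Algebra.adjoin k (Set.range (f ∘ weylGen k n l)), b ≠ 0 ∧ b * q = c := by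
  obtain ⟨a, s, hs, rfl⟩ := hf.2 q
  obtain ⟨p, hp, hpa⟩ := exists_smul_mem_adjoin_weylGen a
  obtain ⟨r, hr, hrs⟩ := exists_smul_mem_adjoin_weylGen s
  have hmem : ∀ z ∈ Algebra.adjoin k (Set.range (weylGen k n l)),
      f z ∈ Algebra.adjoin k (Set.range (f ∘ weylGen k n l)) := by
    intro z hz
    rw [Set.range_comp, ← AlgHom.map_adjoin]
    exact ⟨z, hz, rfl⟩
  let e := algebraMap (MvPolynomial (Fin l) k) (RatFun k l)
  have hfs : f s ≠ 0 := ne_zero_of_injective hf.1 hs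
  -- Numerator and denominator are multiplied by the same central element, which clears both.
  refine ⟨f (e p • e r • s), hmem _ ?_, f (e r • e p • a), hmem _ ?_, ?_, ?_⟩
  · rw [Algebra.smul_def]
    exact mul_mem (algebraMap_mem_adjoin_weylGen p) hrs
  · rw [Algebra.smul_def]
    exact mul_mem (algebraMap_mem_adjoin_weylGen r) hpa
  · exact ne_zero_of_injective hf.1 (smul_ne_zero_of_ne_zero hp (smul_ne_zero_of_ne_zero hr hs))
  · rw [smul_comm]
    simp only [Algebra.smul_def, map_mul, mul_assoc]
    congr 2
    exact mul_inv_cancel_left₀ hfs _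

end WeylGen

/-! ### Recognition of Weyl fields -/

section Recognition

variable {F : Type u} [Field F] {n l : ℕ}

theorem map_mon {U E ι : Type*} [Ring U] [Algebra F U] [Ring E] [Algebra F E] (f : U →ₐ[F] E)
    (w : ι → U) (α : ι →₀ ℕ) : f (mon w α) = mon (f ∘ w) α := by
  simp [mon, word, map_list_prod]

/-- The monomials span the source and their images are independent. No basis theorem for the Weyl
algebra is needed. -/
theorem eq_zero_of_linearIndependent_mon {U E ι : Type*} [Ring U] [Algebra F U] [Ring E]
    [Algebra F E] (f : U →ₐ[F] E) {w : ι → U} (hw : ScalarCommutators F w)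
    (hli : LinearIndependent F (mon (f ∘ w))) {z : U} (hz : z ∈ Algebra.adjoin F (Set.range w))
    (h0 : f z = 0) : z = 0 := by
  obtain ⟨m, hm⟩ := exists_mem_wordSpan_of_mem_adjoin hz
  have h1 : z ∈ Submodule.span F (Set.range (mon w)) :=
    Submodule.span_mono (Set.image_subset_range _ _) (wordSpan_le_span_mon hw _ hm)
  obtain ⟨c, rfl⟩ := Finsupp.mem_span_range_iff_exists_finsupp.1 h1
  have h2 : Finsupp.linearCombination F (mon (f ∘ w)) c = 0 := by
    rw [← h0, Finsupp.linearCombination_apply, Finsupp.sum, Finsupp.sum, map_sum]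
    exact Finset.sum_congr rfl fun α _ => by rw [map_smul, map_mon]
  rw [linearIndependent_iff.1 hli c h2]
  simp

variable {E : Type*} [DivisionRing E] [Algebra F E] {w : WeylIndex n l → E}

theorem IsWeylSystem.t_mem_center (hw : IsWeylSystem w)
    (htop : fractions (hw.scalarCommutators F) = ⊤) (j : Fin l) :
    w (.inr j) ∈ Subalgebra.center F E := by
  rw [Subalgebra.mem_center_iff]
  have hB : ∀ b ∈ Algebra.adjoin F (Set.range w), b * w (.inr j) = w (.inr j) * b := by
    intro b hb
    have hle : Algebra.adjoin F (Set.range w) ≤ Subalgebra.centralizer F {w (.inr j)} := by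
      refine Algebra.adjoin_le ?_
      rintro _ ⟨a, rfl⟩
      exact (Subalgebra.mem_centralizer_iff F).2 fun g hg => by
        rw [Set.mem_singleton_iff.1 hg]; exact hw.t_comm j a
    exact ((Subalgebra.mem_centralizer_iff F).1 (hle hb) _ rfl).symm
  intro q
  obtain ⟨b, hb, c, hc, hb0, rfl⟩ :=
    mem_fractions.1 (show q ∈ fractions (hw.scalarCommutators F) from htop ▸ Subring.mem_top q)
  refine mul_left_cancel₀ hb0 ?_
  rw [← mul_assoc, hB _ hc, ← mul_assoc, ← mul_assoc, hB b hb]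

theorem mon_mapDomain_inr (hw : IsWeylSystem w) (t : Fin l → Subalgebra.center F E)
    (ht : ∀ j, (t j : E) = w (.inr j)) (β : Fin l →₀ ℕ) :
    mon w (β.mapDomain Sum.inr) = (β.prod fun j m => t j ^ m : Subalgebra.center F E) := by
  have hperm : (β.toMultiset.toList.map (Sum.inr : Fin l → WeylIndex n l)).Perm
      (β.mapDomain Sum.inr).toMultiset.toList := by
    rw [← Multiset.coe_eq_coe, ← Multiset.map_coe, Multiset.coe_toList, Multiset.coe_toList,
      Finsupp.toMultiset_map]
  have h1 : mon w (β.mapDomain Sum.inr) =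
      word w (β.toMultiset.toList.map (Sum.inr : Fin l → WeylIndex n l)) := by
    refine (List.Perm.prod_eq' (hperm.map w) ?_).symm
    rw [List.map_map]
    refine List.pairwise_map.2 (List.pairwise_of_forall fun i j => ?_)
    exact hw.t_comm i _
  have h2 : (β.prod fun j m => t j ^ m) = (β.toMultiset.toList.map t).prod := by
    rw [← Multiset.prod_coe, ← Multiset.map_coe, Multiset.coe_toList, Finsupp.toMultiset_map,
      Finsupp.prod_toMultiset, Finsupp.prod_mapDomain_index (by simp) (by simp [pow_add])]
  rw [h1, h2, word, List.map_map]
  have h3 := map_list_prod (Subalgebra.center F E).val (β.toMultiset.toList.map t)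
  rw [List.map_map] at h3
  refine Eq.trans ?_ h3.symm
  congr 2
  funext j
  exact (ht j).symm

theorem aeval_center_injective (hw : IsWeylSystem w) (hli : LinearIndependent F (mon w))
    (t : Fin l → Subalgebra.center F E) (ht : ∀ j, (t j : E) = w (.inr j)) :
    Function.Injective (MvPolynomial.aeval t : MvPolynomial (Fin l) F →ₐ[F] _) := by
  rw [injective_iff_map_eq_zero]
  intro p hp
  have hli' : LinearIndependent F fun β : Fin l →₀ ℕ => mon w (β.mapDomain Sum.inr) :=
    hli.comp _ (Finsupp.mapDomain_injective Sum.inr_injective)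
  have h1 : ∑ β ∈ p.support, p.coeff β • mon w (β.mapDomain Sum.inr) = 0 := by
    have h2 := congrArg (Subalgebra.center F E).val hp
    rw [MvPolynomial.aeval_def, MvPolynomial.eval₂_eq', map_sum, map_zero] at h2
    rw [← h2]
    refine Finset.sum_congr rfl fun β _ => ?_
    rw [mon_mapDomain_inr hw t ht, Algebra.smul_def, map_mul,
      Finsupp.prod_fintype _ _ (by simp)]
    rfl
  ext β
  rw [MvPolynomial.coeff_zero]
  by_contra hβ
  exact hβ (linearIndependent_iff'.1 hli' _ _ h1 β (MvPolynomial.mem_support_iff.2 hβ))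

theorem isUnit_center_of_ne_zero {z : Subalgebra.center F E} (hz : z ≠ 0) : IsUnit z := by
  have hz0 : (z : E) ≠ 0 := fun h => hz (Subtype.ext h)
  refine isUnit_iff_exists_inv.2 ⟨⟨(z : E)⁻¹, ?_⟩, Subtype.ext (mul_inv_cancel₀ hz0)⟩
  exact Set.inv_mem_center z.2

/-- A skew field which consists of the fractions of the algebra generated by a Weyl system, and
has the right transcendence degree, is a Weyl field. -/
theorem IsWeylSystem.isWeylField (hw : IsWeylSystem w)
    (htop : fractions (hw.scalarCommutators F) = ⊤)
    (ht : tdeg F E = ((2 * n + l : ℕ) : EReal)) : IsWeylField F n l E := by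
  have hli : LinearIndependent F (mon w) := by
    refine linearIndependent_mon_of_tdeg (hw.scalarCommutators F) htop (ht.trans ?_)
    congr 1
    simp
    omega
  let t : Fin l → Subalgebra.center F E := fun j => ⟨w (.inr j), hw.t_mem_center htop j⟩
  have hinj := aeval_center_injective hw hli t fun _ => rfl
  -- The central `t_j` are algebraically independent and nonzero central elements are invertible in
  -- the center, so `F(t_1, …, t_l)` maps into it and acts on `E`.
  let c : RatFun F l →+* Subalgebra.center F E := IsLocalization.lift
    (M := (MvPolynomial (Fin l) F)⁰)
    (g := (MvPolynomial.aeval t : MvPolynomial (Fin l) F →ₐ[F] _).toRingHom) fun y =>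
      isUnit_center_of_ne_zero ((map_ne_zero_iff _ hinj).2 (nonZeroDivisors.ne_zero y.2))
  have hc : ∀ p, c (algebraMap _ _ p) = MvPolynomial.aeval t p := fun p =>
    IsLocalization.lift_eq _ p
  let : Algebra (RatFun F l) E := RingHom.toAlgebra' ((Subalgebra.center F E).val.toRingHom.comp c)
    fun r x => (Subalgebra.mem_center_iff.1 (c r).2 x).symm
  have : IsScalarTower F (RatFun F l) E := by
    refine IsScalarTower.of_algebraMap_eq fun r => ?_
    rw [IsScalarTower.algebraMap_apply F (MvPolynomial (Fin l) F) (RatFun F l)]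
    change _ = ((c (algebraMap _ _ (algebraMap F _ r)) : Subalgebra.center F E) : E)
    rw [hc, AlgHom.commutes]
    rfl
  let f₀ : WeylAlgebra (RatFun F l) n →ₐ[RatFun F l] E := RingQuot.liftAlgHom (RatFun F l)
    ⟨FreeAlgebra.lift (RatFun F l) fun a => w (.inl a), by
      rintro _ _ (⟨i, j⟩ | ⟨i, j⟩ | ⟨i, j⟩)
      · simpa using hw.x_comm i j
      · simpa using hw.y_comm i j
      · simpa [apply_ite (FreeAlgebra.lift (RatFun F l) _)] using hw.y_x i j⟩
  let f : WeylAlgebra (RatFun F l) n →ₐ[F] E := f₀.restrictScalars F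
  have hfw : f ∘ weylGen F n l = w := by
    funext a
    rcases a with a | j
    · change f₀ (RingQuot.mkAlgHom _ _ _) = _
      simp [f₀]
    · change f₀ (algebraMap _ _ _) = _
      rw [AlgHom.commutes]
      change ((c (algebraMap _ _ (MvPolynomial.X j)) : Subalgebra.center F E) : E) = _
      rw [hc, MvPolynomial.aeval_X]
  have hf : Function.Injective f := by
    rw [injective_iff_map_eq_zero]
    intro z hz
    by_contra hz0
    obtain ⟨h, hh, hmem⟩ := exists_smul_mem_adjoin_weylGen z
    refine smul_ne_zero_of_ne_zero hh hz0 (eq_zero_of_linearIndependent_mon f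
      ((isWeylSystem_weylGen F n l).scalarCommutators F) (by rwa [hfw]) hmem ?_)
    change f₀ _ = 0
    rw [map_smul, show f₀ z = 0 from hz, smul_zero]
  refine ⟨f, hf, fun q => ?_⟩
  obtain ⟨b, hb, e, he, hb0, hbe⟩ :=
    mem_fractions.1 (show q ∈ fractions (hw.scalarCommutators F) from htop ▸ Subring.mem_top q)
  rw [← hfw, Set.range_comp, ← AlgHom.map_adjoin] at hb he
  obtain ⟨b, -, rfl⟩ := hb
  obtain ⟨e, -, rfl⟩ := he
  refine ⟨e, b, fun h => hb0 (by rw [h]; exact map_zero f), ?_⟩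
  exact (inv_mul_eq_iff_eq_mul₀ hb0).2 hbe.symm |>.symm

end Recognition

/-! ### The skew field of fractions of an Ore domain -/

section SkewFracHom

variable (F R : Type*) [CommRing F] [Ring R] [IsOreDomain R] [Algebra F R]

/-- The inclusion of an Ore domain into its skew field of fractions. -/
def skewFracHom : R →ₐ[F] SkewFrac R :=
  { OreLocalization.numeratorRingHom with commutes' := fun _ => rfl }

theorem isSkewFractionMap_skewFracHom : IsSkewFractionMap (skewFracHom F R).toRingHom := by
  have hinj : Function.Injective (skewFracHom F R) :=
    OreLocalization.numeratorHom_inj fun _ hx => hx.1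
  refine ⟨hinj, fun q => ?_⟩
  induction q using OreLocalization.ind with
  | _ r s =>
  have hs : (s : R) ≠ 0 := nonZeroDivisors.coe_ne_zero s
  refine ⟨r, s, hs, ?_⟩
  refine (eq_inv_mul_iff_mul_eq₀ ((map_ne_zero_iff _ hinj).2 hs)).2 ?_
  exact OreLocalization.mul_cancel

end SkewFracHom

theorem trdeg_fractionRing_of_algEquiv {k Z : Type*} [Field k] [CommRing Z] [Algebra k Z] {r : ℕ}
    (e : MvPolynomial (Fin r) k ≃ₐ[k] Z) : Algebra.trdeg k (FractionRing Z) = r := by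
  have : IsDomain Z := e.toMulEquiv.symm.isDomain _
  have := IsLocalization.isAlgebraic (FractionRing Z) (nonZeroDivisors Z)
  have h1 := e.lift_trdeg_eq
  rw [MvPolynomial.trdeg_of_isDomain] at h1
  have h2 : Algebra.trdeg k Z = r := by simpa using h1.symm
  rw [← trdeg_add_eq k Z, h2, trdeg_eq_zero, add_zero]

/-! ### Transport of a Weyl presentation from `A_k` to `A_F` -/

namespace ZCompatibleFamily

/-- A subring of a skew field of fractions of `A_F` which contains the scalars and the
generators of `A_F`, and is closed under inversion, is everything. -/
theorem eq_top_of_gen_mem (K : ZCompatibleFamily.{u, v}) {F : Type u} [Field F] {E : Type*}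
    [DivisionRing E] [Algebra F E] {j : K.alg F →ₐ[F] E}
    (hj : IsSkewFractionMap j.toRingHom) {S : Subring E}
    (hS : ∀ r, algebraMap F E r ∈ S) (hinv : ∀ q ∈ S, q⁻¹ ∈ S) {g : Set K.ring}
    (hg : Submodule.span ℤ g = K.gen) (hgS : ∀ a ∈ g, j (1 ⊗ₜ a) ∈ S) : S = ⊤ := by
  let f : K.ring →+* E := j.toRingHom.comp
    (Algebra.TensorProduct.includeRight : K.ring →ₐ[ℤ] F ⊗[ℤ] K.ring).toRingHom
  have hgen : 1 ⊔ K.gen ≤ Subalgebra.toSubmodule (subalgebraOfSubring (S.comap f)) := by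
    rw [sup_le_iff, Submodule.one_le, ← hg, Submodule.span_le]
    exact ⟨one_mem (S.comap f), hgS⟩
  have hfil : ∀ m, K.fil m ≤ Subalgebra.toSubmodule (subalgebraOfSubring (S.comap f)) := by
    intro m
    rw [K.fil_eq]
    induction m with
    | zero =>
      rw [pow_zero, Submodule.one_le]
      exact one_mem (S.comap f)
    | succ m ih =>
      rw [pow_succ, Submodule.mul_le]
      exact fun a ha b hb => mul_mem (S := Subring K.ring) (s := S.comap f) (ih ha) (hgen hb)
  have hring : ∀ a : K.ring, j (1 ⊗ₜ a) ∈ S := by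
    intro a
    have ha : a ∈ ⨆ m, K.fil m := K.fil_exhaustive ▸ Submodule.mem_top
    exact (iSup_le hfil : (⨆ m, K.fil m) ≤ _) ha
  have halg : ∀ x : K.alg F, j x ∈ S := by
    intro x
    induction x using TensorProduct.induction_on with
    | zero => rw [map_zero]; exact zero_mem _
    | add x y hx hy => rw [map_add]; exact add_mem hx hy
    | tmul r a =>
      have : (r ⊗ₜ[ℤ] a : K.alg F) = r • (1 ⊗ₜ a) := by
        rw [TensorProduct.smul_tmul', smul_eq_mul, mul_one]
      rw [this, map_smul, Algebra.smul_def]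
      exact mul_mem (hS r) (hring a)
  refine eq_top_iff.2 fun q _ => ?_
  obtain ⟨a, s, -, rfl⟩ := hj.2 q
  exact mul_mem (hinv _ (halg s)) (halg a)

variable (K : ZCompatibleFamily.{u, v}) {k F : Type u} [Field k] [IsAlgClosed k] [Field F]
  [IsAlgClosed F]

section Spec

variable {D E : Type*} [DivisionRing D] [DivisionRing E] [Algebra k D] [Algebra F E]
  {i : K.alg k →ₐ[k] D} {j : K.alg F →ₐ[F] E}

theorem algebraMap_mem_spec (hj : Function.Injective j.toRingHom) (O : ValuationSubring k)
    (φ : O →+* F) (r : O) :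
    (algebraMap k D r, algebraMap F E (φ r)) ∈ K.spec i.toRingHom hj O φ := by
  rw [← i.commutes, ← j.commutes]
  exact K.tmul_mem_spec (i := i.toRingHom) hj O φ r 1

/-- A polynomial expression for `p` involves finitely many scalars; once they lie in `O`, apply `φ`
to them and replace `w` by `w'`. The set `s` depends only on the expression, not on `F`. -/
theorem exists_mem_adjoin_spec {ι : Type*} {w : ι → D} {p : D}
    (hp : p ∈ Algebra.adjoin k (Set.range w)) :
    ∃ s : Finset k, ∀ (F : Type u) [Field F] [IsAlgClosed F] (E : Type (max u v)) [DivisionRing E]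
      [Algebra F E] (j : K.alg F →ₐ[F] E) (hj : Function.Injective j.toRingHom)
      (O : ValuationSubring k) (φ : O →+* F), (s : Set k) ⊆ O →
      ∀ w' : ι → E, (∀ a, (w a, w' a) ∈ K.spec i.toRingHom hj O φ) →
      ∃ p' ∈ Algebra.adjoin F (Set.range w'), (p, p') ∈ K.spec i.toRingHom hj O φ := by
  classical
  induction hp using Algebra.adjoin_induction with
  | mem x hx =>
    obtain ⟨a, rfl⟩ := hx
    exact ⟨∅, fun F _ _ E _ _ j hj O φ _ w' hw' => ⟨w' a, Algebra.subset_adjoin ⟨a, rfl⟩, hw' a⟩⟩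
  | algebraMap r =>
    refine ⟨{r}, fun F _ _ E _ _ j hj O φ hs w' _ => ?_⟩
    have hr : r ∈ O := hs (by simp)
    exact ⟨_, algebraMap_mem _ _, K.algebraMap_mem_spec hj O φ ⟨r, hr⟩⟩
  | add x y _ _ hx hy =>
    obtain ⟨s, hs⟩ := hx
    obtain ⟨t, ht⟩ := hy
    refine ⟨s ∪ t, fun F _ _ E _ _ j hj O φ hst w' hw' => ?_⟩
    rw [Finset.coe_union, Set.union_subset_iff] at hst
    obtain ⟨x', hx', hx⟩ := hs F E j hj O φ hst.1 w' hw'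
    obtain ⟨y', hy', hy⟩ := ht F E j hj O φ hst.2 w' hw'
    exact ⟨x' + y', add_mem hx' hy', add_mem hx hy⟩
  | mul x y _ _ hx hy =>
    obtain ⟨s, hs⟩ := hx
    obtain ⟨t, ht⟩ := hy
    refine ⟨s ∪ t, fun F _ _ E _ _ j hj O φ hst w' hw' => ?_⟩
    rw [Finset.coe_union, Set.union_subset_iff] at hst
    obtain ⟨x', hx', hx⟩ := hs F E j hj O φ hst.1 w' hw'
    obtain ⟨y', hy', hy⟩ := ht F E j hj O φ hst.2 w' hw'
    exact ⟨x' * y', mul_mem hx' hy', mul_mem hx hy⟩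

/-- The graph projects injectively to `D`, so the relations hold in the graph, and the other
projection carries them to `E`. -/
theorem isWeylSystem_of_mem_spec (hi : Function.Injective i.toRingHom)
    {hj : Function.Injective j.toRingHom} {O : ValuationSubring k} {φ : O →+* F} {n l : ℕ}
    {w : WeylIndex n l → D} {w' : WeylIndex n l → E} (hw : IsWeylSystem w)
    (hw' : ∀ a, (w a, w' a) ∈ K.spec i.toRingHom hj O φ) : IsWeylSystem w' := by
  let Γ := K.spec i.toRingHom hj O φ
  let W : WeylIndex n l → Γ := fun a => ⟨(w a, w' a), hw' a⟩
  have hinj : Function.Injective ((RingHom.fst D E).comp Γ.subtype) := by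
    rintro ⟨⟨x, y⟩, h⟩ ⟨⟨x', y'⟩, h'⟩ (rfl : x = x')
    obtain rfl := K.eq_of_mem_spec hi h h'
    rfl
  exact (IsWeylSystem.of_map (w := W) hinj hw).map ((RingHom.snd D E).comp Γ.subtype)

/-- A presentation of `Frac A_k` as a Weyl field specializes to `Frac A_F`. -/
theorem exists_weylSystem_of_spec (hi : IsSkewFractionMap i.toRingHom) {n l : ℕ}
    {f : WeylAlgebra (RatFun k l) n →ₐ[k] D} (hf : IsSkewFractionMap f.toRingHom) :
    ∃ s : Finset k, ∀ (F : Type u) [Field F] [IsAlgClosed F] (E : Type (max u v)) [DivisionRing E]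
      [Algebra F E] (j : K.alg F →ₐ[F] E) (_ : IsSkewFractionMap j.toRingHom)
      (O : ValuationSubring k) (_ : O →+* F), (s : Set k) ⊆ O →
      ∃ (w : WeylIndex n l → E) (hw : IsWeylSystem w),
        fractions (hw.scalarCommutators F) = ⊤ := by
  classical
  let w : WeylIndex n l → D := f ∘ weylGen k n l
  obtain ⟨g, hg⟩ := K.gen_fg
  -- `s₁` lets the Weyl generators specialize, `s₂` and `s₃` keep denominators and numerators
  -- polynomial in them, and `s₄` keeps the denominators nonzero.
  choose s₁ hs₁ using fun a => K.exists_mem_spec hi (w a)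
  choose b hb c hc hb0 hbc using fun v : K.ring =>
    exists_fraction_adjoin_weylGen hf (i (1 ⊗ₜ v))
  choose s₂ hs₂ using fun v => K.exists_mem_adjoin_spec (i := i) (hb v)
  choose s₃ hs₃ using fun v => K.exists_mem_adjoin_spec (i := i) (hc v)
  choose s₄ hs₄ using fun v => K.exists_mem_spec hi (b v)
  refine ⟨Finset.univ.biUnion s₁ ∪ (g.biUnion s₂ ∪ (g.biUnion s₃ ∪ g.biUnion s₄)),
    fun F _ _ E _ _ j hj O φ hO => ?_⟩
  simp only [Finset.coe_union, Set.union_subset_iff, Finset.coe_biUnion, Set.iUnion_subset_iff]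
    at hO
  obtain ⟨hO₁, hO₂, hO₃, hO₄⟩ := hO
  choose w' hw' _ using fun a => hs₁ a F E j.toRingHom hj.1 O φ (hO₁ a (by simp))
  have hsys := K.isWeylSystem_of_mem_spec hi.1
    ((isWeylSystem_weylGen k n l).map f.toRingHom) hw'
  refine ⟨w', hsys, K.eq_top_of_gen_mem (F := F) hj
    (fun r => mem_fractions_of_mem_adjoin (algebraMap_mem _ r)) (fun _ => inv_mem_fractions) hg
    fun v hv => ?_⟩
  obtain ⟨b', hb', hbb'⟩ := hs₂ v F E j hj.1 O φ (hO₂ v hv) w' hw'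
  obtain ⟨c', hc', hcc'⟩ := hs₃ v F E j hj.1 O φ (hO₃ v hv) w' hw'
  obtain ⟨b'', hbb'', hb''⟩ := hs₄ v F E j.toRingHom hj.1 O φ (hO₄ v hv)
  -- By uniqueness, the specialization lying in the generated algebra is also the nonzero one.
  obtain rfl := K.eq_of_mem_spec hi.1 hbb' hbb''
  refine mem_fractions.2 ⟨b', hb', c', hc', hb'' (hb0 v), ?_⟩
  have h1 := K.tmul_mem_spec (i := i.toRingHom) hj.1 O φ 1 v
  rw [map_one, OneMemClass.coe_one] at h1
  have h2 := mul_mem hbb' h1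
  rw [Prod.mk_mul_mk] at h2
  refine K.eq_of_mem_spec hi.1 (x := c v) ?_ hcc'
  rw [← hbc v]
  exact h2

end Spec

/-- The finitely generated torsion-free module of generators is free, and its base change embeds in
`A_F`. Hence the transcendence degree is the same for all fields. -/
theorem finrank_gen_baseChange (F : Type u) [Field F] [IsAlgClosed F] :
    Module.finrank F (K.gen.baseChange F) = Module.finrank ℤ K.gen := by
  have : CharZero K.ring := K.charZero_ring
  have : Module.Finite ℤ K.gen := Module.Finite.iff_fg.2 K.gen_fg
  have : Module.Free ℤ K.gen := Module.free_of_finite_type_torsion_free'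
  refine Eq.trans ?_ (Module.finrank_baseChange (R := F) (S := ℤ) (M' := K.gen))
  exact LinearMap.finrank_range_of_inj (K.gen_baseChange F)

theorem trdeg_frac_center (k : Type u) [Field k] [IsAlgClosed k] [CharZero k] :
    Algebra.trdeg k (FractionRing (Subalgebra.center k (K.alg k))) = K.numCentral := by
  obtain ⟨e, -⟩ := K.center_polynomial k
  exact trdeg_fractionRing_of_algEquiv (Z := Subalgebra.center k (K.alg k)) e

theorem isWeylField_of_weylSystem {n l : ℕ} (hdim : Module.finrank ℤ K.gen = 2 * n + l)
    {w : WeylIndex n l → SkewFrac (K.alg F)} (hw : IsWeylSystem w)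
    (htop : fractions (hw.scalarCommutators F) = ⊤) : IsWeylField F n l (SkewFrac (K.alg F)) := by
  refine hw.isWeylField htop ?_
  rw [K.tdeg_frac, K.finrank_gen_baseChange, hdim]

/-- If the Gelfand–Kirillov conjecture holds for one algebraically closed field of characteristic
zero, then `Frac A_F` is a Weyl field, with the same parameters, for all algebraically closed
fields outside finitely many prime characteristics. -/
theorem exists_isWeylField_of_gelfandKirillov [CharZero k] (h : K.GelfandKirillov k) :
    ∃ n l : ℕ, Module.finrank ℤ K.gen = 2 * n + l ∧ l = K.numCentral ∧
      ∃ m : ℤ, m ≠ 0 ∧ ∀ (F : Type u) [Field F] [IsAlgClosed F], (m : F) ≠ 0 →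
        IsWeylField F n l (SkewFrac (K.alg F)) := by
  obtain ⟨n, l, ⟨f, hf⟩, ht, hl⟩ := h
  rw [K.tdeg_frac, K.finrank_gen_baseChange, Nat.cast_inj] at ht
  rw [K.trdeg_frac_center, Nat.cast_inj] at hl
  obtain ⟨s, hs⟩ := K.exists_weylSystem_of_spec (isSkewFractionMap_skewFracHom k (K.alg k)) hf
  obtain ⟨m, hm0, hm⟩ := exists_valuationSubring_hom_of_finset s
  refine ⟨n, l, ht, hl.symm, m, hm0, fun F _ _ hmF => ?_⟩
  obtain ⟨O, hO, ⟨φ⟩⟩ := hm F hmF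
  obtain ⟨w, hw, htop⟩ := hs F (SkewFrac (K.alg F)) (skewFracHom F (K.alg F))
    (isSkewFractionMap_skewFracHom F (K.alg F)) O φ hO
  exact K.isWeylField_of_weylSystem ht hw htop

end ZCompatibleFamily

end GK

end

theorem mainTheorem3 (K : GK.ZCompatibleFamily.{u, v})
    (h : ∃ (k : Type u) (_ : Field k) (_ : IsAlgClosed k) (_ : CharZero k), K.GelfandKirillov k) :
    (∀ (k : Type u) [Field k] [IsAlgClosed k] [CharZero k], K.GelfandKirillov k) ∧
    ∃ N : ℕ, ∀ (p : ℕ) [Fact p.Prime], N < p →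
      ∀ (F : Type u) [Field F] [IsAlgClosed F] [CharP F p], K.ModularGelfandKirillov F := by
  obtain ⟨k, _, _, _, h⟩ := h
  obtain ⟨n, l, hdim, hl, m, hm0, hm⟩ := K.exists_isWeylField_of_gelfandKirillov h
  refine ⟨fun k' _ _ _ => ⟨n, l, hm k' (Int.cast_ne_zero.2 hm0), ?_, ?_⟩,
    m.natAbs, fun p _ hp F _ _ _ => ⟨n, l, hm F fun h0 => ?_⟩⟩
  · rw [K.tdeg_frac, K.finrank_gen_baseChange, hdim]
  · rw [K.trdeg_frac_center, hl]
  -- A prime exceeding `|m|` cannot divide the nonzero integer `m`.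
  · rw [CharP.intCast_eq_zero_iff F p] at h0
    have := Nat.le_of_dvd (Int.natAbs_pos.2 hm0) (Int.natCast_dvd.1 h0)
    omega
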